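/- Let $A\in\mathbb R^{n\times n}$, $B_1,B_2,B_3\in\mathbb R^{n\times m}$ and $0\le\tau_1\le\tau_2\le\tau_3<\infty$, and consider the system with three input delays $$\dot x(t)=Ax(t)+\sum_{i=1}^{3}B_i\,u(t-\tau_i),\qquad t\ge 0 .$$ Put $\tau=\tau_1+\tau_2+\tau_3$ and $B=\sum_{i=1}^{3}e^{-A\tau_i}B_i$, and assume that the pair $(A,B)$ is controllable and that all eigenvalues of $A$ lie on the imaginary axis. Then for every $\gamma>0$ the parametric algebraic Riccati equation $$A^{\mathsf T}P+PA-PBB^{\mathsf T}P=-\gamma P$$ has a unique positive definite solution $P=P(\gamma)$. Let $F=F(\gamma)=-B^{\mathsf T}P(\gamma)$. There exists $\gamma^*>0$ such that for every $\gamma\in(0,\gamma^*)$ the closed-loop system consisting of the delay system and the truncated pseudo-predictor feedback $$u(t)=F\,e^{(A+BF)\tau}\,e^{-A\tau}\,x(t)$$ is asymptotically stable, i.e., with initial histories in $C([-\tau_3,0],\mathbb R^n)$ with the uniform norm, the zero solution is Lyapunov stable and every solution tends to $0$ as $t\to\infty$. -/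

import Mathlib

open Set Filter Topology
open scoped Matrix

namespace TPPF

/-- All (complex) eigenvalues of the real square matrix `A` lie on the imaginary axis. -/
def EigenvaluesImaginary {n : ℕ} (A : Matrix (Fin n) (Fin n) ℝ) : Prop :=
  ∀ s ∈ spectrum ℂ (A.map (fun a : ℝ => (a : ℂ))), s.re = 0

/-- Controllability of the pair `(A, B)`: any state `x₀` can be steered to any state `x₁` in some
finite time `T > 0` along `ẋ = A x + B u` by a continuous input `u` on `[0, T]`. -/
def Controllable {n m : ℕ} (A : Matrix (Fin n) (Fin n) ℝ) (B : Matrix (Fin n) (Fin m) ℝ) : Prop :=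
  ∀ x₀ x₁ : Fin n → ℝ, ∃ T : ℝ, 0 < T ∧ ∃ (x : ℝ → Fin n → ℝ) (u : ℝ → Fin m → ℝ),
    ContinuousOn u (Icc 0 T) ∧
    (∀ t ∈ Icc 0 T, HasDerivWithinAt x (A *ᵥ x t + B *ᵥ u t) (Icc 0 T) t) ∧
    x 0 = x₀ ∧ x T = x₁

/-- The matrix `B = e^{-Aτ₁} B₁ + e^{-Aτ₂} B₂ + e^{-Aτ₃} B₃` of the delay-free reduced system. -/
noncomputable def reducedInput {n m : ℕ} (A : Matrix (Fin n) (Fin n) ℝ)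
    (Bd : Fin 3 → Matrix (Fin n) (Fin m) ℝ) (τ : Fin 3 → ℝ) : Matrix (Fin n) (Fin m) ℝ :=
  ∑ i, NormedSpace.exp (-(τ i • A)) * Bd i

/-- `P` is a positive definite (in particular symmetric) solution of the parametric algebraic
Riccati equation `Aᵀ P + P A - P B Bᵀ P = -γ P`. -/
def IsRiccatiSolution {n m : ℕ} (A : Matrix (Fin n) (Fin n) ℝ) (B : Matrix (Fin n) (Fin m) ℝ)
    (γ : ℝ) (P : Matrix (Fin n) (Fin n) ℝ) : Prop :=
  P.PosDef ∧ Aᵀ * P + P * A - P * B * Bᵀ * P = -(γ • P)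

/-- The gain `F e^{(A+BF)τ} e^{-Aτ}` of the truncated pseudo-predictor feedback, with
`F = -Bᵀ P`; here `σ` stands for the total delay `τ = τ₁ + τ₂ + τ₃`. -/
noncomputable def tppfGain {n m : ℕ} (A : Matrix (Fin n) (Fin n) ℝ) (B : Matrix (Fin n) (Fin m) ℝ)
    (P : Matrix (Fin n) (Fin n) ℝ) (σ : ℝ) : Matrix (Fin m) (Fin n) ℝ :=
  let F : Matrix (Fin m) (Fin n) ℝ := -(Bᵀ * P)
  F * NormedSpace.exp (σ • (A + B * F)) * NormedSpace.exp (-(σ • A))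

/-- `x` is a trajectory of `ẋ(t) = A x(t) + ∑ᵢ Bᵢ u(t - τᵢ)`, `t ≥ 0`, driven by the input `u`
and continuous on the half-line `[-r, ∞)`, where `[-r, 0]` carries the initial history. Values of
`x` before time `-r` are irrelevant when every `τᵢ ≤ r` and `u(t)` depends on `x(t)` only. -/
def IsTrajectory {n m : ℕ} (A : Matrix (Fin n) (Fin n) ℝ) (Bd : Fin 3 → Matrix (Fin n) (Fin m) ℝ)
    (τ : Fin 3 → ℝ) (r : ℝ) (x : ℝ → Fin n → ℝ) (u : ℝ → Fin m → ℝ) : Prop :=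
  ContinuousOn x (Ici (-r)) ∧
  ∀ t, 0 ≤ t → HasDerivWithinAt x (A *ᵥ x t + ∑ i, Bd i *ᵥ u (t - τ i)) (Ici 0) t

/-- Asymptotic stability of the zero solution of the retarded system
`ẋ(t) = A x(t) + ∑ᵢ Bᵢ u(t - τᵢ)` closed by the static feedback `u(t) = K x(t)`, in the phase
space of continuous histories on `[-r, 0]` with the uniform norm: Lyapunov stability, together
with convergence to zero of every trajectory (the system is linear, so that local and global
attractivity agree). The norm on `Fin n → ℝ` is the maximum norm; the notion is the same for every
norm on `ℝⁿ`. -/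
def ClosedLoopAsymptoticallyStable {n m : ℕ} (A : Matrix (Fin n) (Fin n) ℝ)
    (Bd : Fin 3 → Matrix (Fin n) (Fin m) ℝ) (τ : Fin 3 → ℝ) (r : ℝ)
    (K : Matrix (Fin m) (Fin n) ℝ) : Prop :=
  (∀ ε : ℝ, 0 < ε → ∃ δ : ℝ, 0 < δ ∧ ∀ x : ℝ → Fin n → ℝ,
    IsTrajectory A Bd τ r x (fun t => K *ᵥ x t) →
    (∀ θ ∈ Icc (-r) 0, ‖x θ‖ < δ) → ∀ t, 0 ≤ t → ‖x t‖ < ε) ∧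
  (∀ x : ℝ → Fin n → ℝ,
    IsTrajectory A Bd τ r x (fun t => K *ᵥ x t) → Tendsto x atTop (𝓝 0))

end TPPF

namespace TPPF

/-! Inverting the Riccati equation makes it linear: `W = P⁻¹` satisfies `A W + W Aᵀ + γ W = B Bᵀ`, a
Lyapunov equation for `-(Aᵀ + γ/2)`. This matrix is Hurwitz because the spectrum of `A` is
imaginary, so `W` exists and is unique; controllability makes it positive definite
(`existsUnique_isRiccatiSolution`).

Three facts make `P` a low-gain weight. Since `tr A = 0`, the equation gives `tr (Bᵀ P B) = n γ`, so
the feedback `Bᵀ P z` has size `O(√γ)` in the norm `|z|_P = (zᵀ P z)^(1/2)` (`feedback_sq_le`).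
Moreover `P(γ) ≤ P(1)` for `γ ≤ 1` (`dotProduct_le`), so the norms of `B` and the `Bᵢ` into `|·|_P`
are bounded uniformly in `γ`. Finally, over time `σ` the flow of `A + B F` contracts `|·|_P` and
that of `-A` expands it by at most `e^σ`.

Adding to `x` the effect of inputs still in transit gives a predictor `y` with `ẏ = A y + B u` and
no delay. For `V = yᵀ P y`, completing the square yields `V̇ = -γ V + |u + Bᵀ P y|² - |u|²`. Both `x
- y` and `e^{(A+BF)σ} e^{-Aσ} x - x` are `O(√γ)` times the recent maximum `M` of `|x|_P`; the
low-gain estimate then gives `V̇ ≤ -γ (V - (ε M)²)` with `ε = O(√γ)` (`delayDecay_closedLoop`). For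
`ε ≤ 1/4` a small-gain argument in the style of Halanay gives stability and convergence
(`DelayDecay.bounded`, `DelayDecay.tendsto_zero`). -/

variable {n m : ℕ}

/-! ### Calculus of matrix exponentials and bilinear forms. -/

lemma hasDerivAt_exp_smul_apply (A : Matrix (Fin n) (Fin n) ℝ) (t : ℝ) (i j : Fin n) :
    HasDerivAt (fun s : ℝ => NormedSpace.exp (s • A) i j) ((A * NormedSpace.exp (t • A)) i j) t := by
  let _ := Matrix.linftyOpNormedRing (n := Fin n) (α := ℝ)
  let _ := Matrix.linftyOpNormedAlgebra (n := Fin n) (R := ℝ) (α := ℝ)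
  have h := hasDerivAt_exp_smul_const' A t
  exact hasDerivAt_pi.1 (hasDerivAt_pi.1 h i) j

lemma hasSum_exp_apply {𝕜 : Type*} [RCLike 𝕜] (A : Matrix (Fin n) (Fin n) 𝕜) (i j : Fin n) :
    HasSum (fun k : ℕ => ((k.factorial : 𝕜)⁻¹ • A ^ k) i j) (NormedSpace.exp A i j) := by
  let _ := Matrix.linftyOpNormedRing (n := Fin n) (α := 𝕜)
  let _ := Matrix.linftyOpNormedAlgebra (n := Fin n) (R := 𝕜) (α := 𝕜)
  have _ : @CompleteSpace (Matrix (Fin n) (Fin n) 𝕜) PseudoMetricSpace.toUniformSpace :=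
    FiniteDimensional.complete 𝕜 _
  have h := NormedSpace.exp_series_hasSum_exp' (𝕂 := 𝕜) A
  exact Pi.hasSum.1 (Pi.hasSum.1 h i) j

lemma exp_map_ofReal (A : Matrix (Fin n) (Fin n) ℝ) (t : ℝ) (i j : Fin n) :
    (NormedSpace.exp (t • A) i j : ℂ) =
      NormedSpace.exp ((t : ℂ) • A.map (fun a : ℝ => (a : ℂ))) i j := by
  refine (Complex.hasSum_ofReal.2 (hasSum_exp_apply (t • A) i j)).unique ?_
  refine HasSum.congr_fun (hasSum_exp_apply ((t : ℂ) • A.map (fun a : ℝ => (a : ℂ))) i j) fun k => ?_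
  have h : (t : ℂ) • A.map (fun a : ℝ => (a : ℂ)) = Complex.ofRealHom.mapMatrix (t • A) := by
    ext; simp
  rw [h, ← map_pow]
  simp

lemma hasDerivWithinAt_dotProduct {f g : ℝ → Fin n → ℝ} {f' g' : Fin n → ℝ} {s : Set ℝ} {t : ℝ}
    (hf : HasDerivWithinAt f f' s t) (hg : HasDerivWithinAt g g' s t) :
    HasDerivWithinAt (fun r => f r ⬝ᵥ g r) (f' ⬝ᵥ g t + f t ⬝ᵥ g') s t := by
  have h := HasDerivWithinAt.fun_sum (u := Finset.univ) fun i _ =>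
    (hasDerivWithinAt_pi.1 hf i).mul (hasDerivWithinAt_pi.1 hg i)
  rw [Finset.sum_add_distrib] at h
  exact h

lemma hasDerivWithinAt_mulVec (M : Matrix (Fin m) (Fin n) ℝ) {f : ℝ → Fin n → ℝ}
    {f' : Fin n → ℝ} {s : Set ℝ} {t : ℝ} (hf : HasDerivWithinAt f f' s t) :
    HasDerivWithinAt (fun r => M *ᵥ f r) (M *ᵥ f') s t :=
  hasDerivWithinAt_pi.2 fun i => by
    have h := hasDerivWithinAt_dotProduct (hasDerivWithinAt_const t s (M i)) hf
    simpa [Matrix.mulVec] using h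

lemma hasDerivWithinAt_bilin (X : Matrix (Fin n) (Fin n) ℝ) {f g : ℝ → Fin n → ℝ}
    {f' g' : Fin n → ℝ} {s : Set ℝ} {t : ℝ}
    (hf : HasDerivWithinAt f f' s t) (hg : HasDerivWithinAt g g' s t) :
    HasDerivWithinAt (fun r => f r ⬝ᵥ X *ᵥ g r) (f' ⬝ᵥ X *ᵥ g t + f t ⬝ᵥ X *ᵥ g') s t :=
  hasDerivWithinAt_dotProduct hf (hasDerivWithinAt_mulVec X hg)

lemma hasDerivWithinAt_exp_smul_mulVec (A : Matrix (Fin n) (Fin n) ℝ) {f : ℝ → Fin n → ℝ}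
    {f' : Fin n → ℝ} {s : Set ℝ} {t : ℝ} (hf : HasDerivWithinAt f f' s t) :
    HasDerivWithinAt (fun r => NormedSpace.exp (r • A) *ᵥ f r)
      (A *ᵥ (NormedSpace.exp (t • A) *ᵥ f t) + NormedSpace.exp (t • A) *ᵥ f') s t :=
  hasDerivWithinAt_pi.2 fun i => by
    have hE : HasDerivWithinAt (fun r => NormedSpace.exp (r • A) i)
        ((A * NormedSpace.exp (t • A)) i) s t :=
      hasDerivWithinAt_pi.2 fun j => (hasDerivAt_exp_smul_apply A t i j).hasDerivWithinAt
    have h := hasDerivWithinAt_dotProduct hE hf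
    rw [Matrix.mulVec_mulVec]
    exact h

lemma hasDerivAt_exp_smul_mulVec_const (A : Matrix (Fin n) (Fin n) ℝ) (v : Fin n → ℝ) (t : ℝ) :
    HasDerivAt (fun r : ℝ => NormedSpace.exp (r • A) *ᵥ v)
      (A *ᵥ (NormedSpace.exp (t • A) *ᵥ v)) t := by
  have h := hasDerivWithinAt_exp_smul_mulVec A (hasDerivWithinAt_const t univ v)
  simpa [hasDerivWithinAt_univ] using h

lemma exp_smul_mulVec_neg (A : Matrix (Fin n) (Fin n) ℝ) (t : ℝ) (v : Fin n → ℝ) :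
    NormedSpace.exp (t • A) *ᵥ (NormedSpace.exp (t • -A) *ᵥ v) = v := by
  rw [Matrix.mulVec_mulVec, ← Matrix.exp_add_of_commute]
  · simp
  · simp

/-! ### Hurwitz matrices and spectral consequences. -/

/-- All complex eigenvalues of the real matrix `M` have negative real part. -/
def IsHurwitz (M : Matrix (Fin n) (Fin n) ℝ) : Prop :=
  ∀ s ∈ spectrum ℂ (M.map (fun a : ℝ => (a : ℂ))), s.re < 0

lemma exp_smul_one (c : ℂ) :
    NormedSpace.exp (c • (1 : Matrix (Fin n) (Fin n) ℂ)) = Complex.exp c • 1 := by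
  rw [Matrix.smul_one_eq_diagonal, Matrix.smul_one_eq_diagonal, Matrix.exp_diagonal]
  congr 1
  ext i
  rw [Pi.coe_exp, Complex.exp_eq_exp_ℂ]

lemma exp_mulVec_eq_sum (N : Matrix (Fin n) (Fin n) ℂ) (v : Fin n → ℂ) (k : ℕ)
    (hk : N ^ k *ᵥ v = 0) :
    NormedSpace.exp N *ᵥ v = ∑ j ∈ Finset.range k, (j.factorial : ℂ)⁻¹ • (N ^ j *ᵥ v) := by
  ext i
  have h1 : HasSum (fun j : ℕ => ((j.factorial : ℂ)⁻¹ • (N ^ j *ᵥ v)) i)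
      ((NormedSpace.exp N *ᵥ v) i) := by
    have := hasSum_sum (s := Finset.univ)
      fun l _ => (hasSum_exp_apply N i l).mul_right (v l)
    simp_rw [← Matrix.smul_mulVec]
    exact this
  have h2 := hasSum_sum_of_ne_finset_zero (s := Finset.range k) (L := .unconditional ℕ)
    (f := fun j : ℕ => ((j.factorial : ℂ)⁻¹ • (N ^ j *ᵥ v)) i) fun j hj => by
      have : N ^ j *ᵥ v = 0 := by
        rw [← Nat.sub_add_cancel (not_lt.1 (Finset.mem_range.not.1 hj)), pow_add,
          ← Matrix.mulVec_mulVec, hk, Matrix.mulVec_zero]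
      simp [this]
  exact (h1.unique h2).trans (Finset.sum_apply _ _ _).symm

lemma tendsto_pow_mul_cexp {μ : ℂ} (hμ : μ.re < 0) (j : ℕ) :
    Tendsto (fun t : ℝ => (t : ℂ) ^ j * Complex.exp (t * μ)) atTop (𝓝 0) := by
  rw [tendsto_zero_iff_norm_tendsto_zero]
  refine (tendsto_rpow_mul_exp_neg_mul_atTop_nhds_zero j (-μ.re) (by linarith)).congr' ?_
  filter_upwards [eventually_ge_atTop 0] with t ht
  simp [Complex.norm_exp, abs_of_nonneg ht, mul_comm]

/-- Generalized eigenvectors span. On one for `μ`, `N = M - μ` is nilpotent, so `e^{tM} v` is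
`e^{tμ}` times a polynomial in `t`. -/
lemma tendsto_exp_smul_mulVec_complex (M : Matrix (Fin n) (Fin n) ℂ)
    (hM : ∀ s ∈ spectrum ℂ M, s.re < 0) (v : Fin n → ℂ) :
    Tendsto (fun t : ℝ => NormedSpace.exp ((t : ℂ) • M) *ᵥ v) atTop (𝓝 0) := by
  have hv : v ∈ ⨆ μ : ℂ, Module.End.maxGenEigenspace (Matrix.toLin' M) μ := by
    rw [Module.End.iSup_maxGenEigenspace_eq_top]; trivial
  induction hv using Submodule.iSup_induction' with
  | zero => simp
  | add x y _ _ hx hy => simpa [Matrix.mulVec_add] using hx.add hy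
  | mem μ v hv =>
    rcases eq_or_ne v 0 with rfl | hv0
    · simp
    have hμ : μ.re < 0 := by
      apply hM
      rw [← Matrix.spectrum_toLin', ← Module.End.hasEigenvalue_iff_mem_spectrum]
      obtain ⟨k, hk⟩ := (Module.End.mem_maxGenEigenspace _ _ _).1 hv
      refine Module.End.hasEigenvalue_of_hasGenEigenvalue (k := k) ?_
      refine (Submodule.ne_bot_iff _).2 ⟨v, ?_, hv0⟩
      exact Module.End.mem_genEigenspace_nat.2 hk
    obtain ⟨k, hk⟩ := (Module.End.mem_maxGenEigenspace _ _ _).1 hv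
    set N := M - μ • 1 with hN
    have hk' : N ^ k *ᵥ v = 0 := by
      have : (Matrix.toLin' M - μ • 1) = Matrix.toLin' N := by
        simp [hN, Module.End.one_eq_id]
      rwa [this, ← Matrix.toLin'_pow, Matrix.toLin'_apply] at hk
    have key : ∀ t : ℝ, NormedSpace.exp ((t : ℂ) • M) *ᵥ v = ∑ j ∈ Finset.range k,
        ((t : ℂ) ^ j * Complex.exp (t * μ)) • ((j.factorial : ℂ)⁻¹ • (N ^ j *ᵥ v)) := by
      intro t
      have h1 : (t : ℂ) • M = (t * μ : ℂ) • (1 : Matrix (Fin n) (Fin n) ℂ) + (t : ℂ) • N := by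
        rw [hN, smul_sub, smul_smul]; abel
      rw [h1, Matrix.exp_add_of_commute _ _ ((Commute.one_left _).smul_left _), exp_smul_one,
        smul_mul_assoc, one_mul, Matrix.smul_mulVec, exp_mulVec_eq_sum ((t : ℂ) • N) v k
          (by rw [smul_pow, Matrix.smul_mulVec, hk', smul_zero]), Finset.smul_sum]
      refine Finset.sum_congr rfl fun j _ => ?_
      rw [smul_pow, Matrix.smul_mulVec, smul_smul, smul_smul, smul_smul]
      congr 1
      ring
    simp_rw [key]
    have := tendsto_finsetSum (Finset.range k) fun j _ =>
      (tendsto_pow_mul_cexp hμ j).smul_const ((j.factorial : ℂ)⁻¹ • (N ^ j *ᵥ v))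
    simpa using this

lemma IsHurwitz.tendsto_exp_smul_mulVec {M : Matrix (Fin n) (Fin n) ℝ} (hM : IsHurwitz M)
    (v : Fin n → ℝ) :
    Tendsto (fun t : ℝ => NormedSpace.exp (t • M) *ᵥ v) atTop (𝓝 0) := by
  rw [tendsto_pi_nhds]
  intro i
  have h := tendsto_pi_nhds.1
    (tendsto_exp_smul_mulVec_complex _ hM (fun j => (v j : ℂ))) i
  have h2 := (Complex.continuous_re.tendsto _).comp h
  refine h2.congr fun t => ?_
  simp [Matrix.mulVec, dotProduct, ← exp_map_ofReal, -Complex.coe_smul]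

lemma EigenvaluesImaginary.isHurwitz {A : Matrix (Fin n) (Fin n) ℝ} (hA : EigenvaluesImaginary A)
    {γ : ℝ} (hγ : 0 < γ) : IsHurwitz (-(Aᵀ + (γ / 2) • 1)) := by
  intro s hs
  -- If `s` is an eigenvalue of `-(Aᵀ + γ/2)`, then `-(s + γ/2)` is one of `A`, whence `Re s =
  -- -γ/2`.
  have h := hA (-(s + γ / 2)) ?_
  · simp at h
    linarith
  rw [spectrum.mem_iff] at hs ⊢
  rw [← Matrix.isUnit_transpose, ← IsUnit.neg_iff]
  convert hs using 2
  ext i j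
  by_cases hij : j = i
  · subst hij; simp [Algebra.algebraMap_eq_smul_one]; ring
  · simp [Algebra.algebraMap_eq_smul_one, Matrix.one_apply_ne' hij]

lemma EigenvaluesImaginary.trace_eq_zero {A : Matrix (Fin n) (Fin n) ℝ}
    (hA : EigenvaluesImaginary A) : A.trace = 0 := by
  have h := Matrix.trace_eq_sum_roots_charpoly (A.map (fun a : ℝ => (a : ℂ)))
  have h2 : (A.trace : ℂ) = (A.map (fun a : ℝ => (a : ℂ))).trace := by
    simp [Matrix.trace]
  rw [← h2] at h
  have h3 := congrArg Complex.re h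
  rw [Complex.ofReal_re] at h3
  rw [h3, show ∀ z : ℂ, z.re = Complex.reAddGroupHom z from fun _ => rfl, map_multiset_sum]
  refine Multiset.sum_eq_zero fun x hx => ?_
  obtain ⟨s, hs, rfl⟩ := Multiset.mem_map.1 hx
  exact hA s (Matrix.mem_spectrum_of_isRoot_charpoly (Polynomial.isRoot_of_mem_roots hs))

/-! ### Lyapunov equations and controllability. -/

lemma dotProduct_lyapunov (K X : Matrix (Fin n) (Fin n) ℝ) (w z : Fin n → ℝ) :
    (K *ᵥ w) ⬝ᵥ X *ᵥ z + w ⬝ᵥ X *ᵥ (K *ᵥ z) = w ⬝ᵥ (Kᵀ * X + X * K) *ᵥ z := by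
  rw [Matrix.add_mulVec, dotProduct_add, ← Matrix.mulVec_mulVec, ← Matrix.mulVec_mulVec,
    Matrix.dotProduct_mulVec w Kᵀ, Matrix.vecMul_transpose]

lemma hasDerivAt_lyapunov (K X : Matrix (Fin n) (Fin n) ℝ) (w v : Fin n → ℝ) (t : ℝ) :
    HasDerivAt (fun t : ℝ => (NormedSpace.exp (t • K) *ᵥ w) ⬝ᵥ X *ᵥ (NormedSpace.exp (t • K) *ᵥ v))
      ((NormedSpace.exp (t • K) *ᵥ w) ⬝ᵥ (Kᵀ * X + X * K) *ᵥ (NormedSpace.exp (t • K) *ᵥ v)) t := by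
  have h := hasDerivWithinAt_bilin (s := univ) X
    (hasDerivAt_exp_smul_mulVec_const K w t).hasDerivWithinAt
    (hasDerivAt_exp_smul_mulVec_const K v t).hasDerivWithinAt
  rwa [hasDerivWithinAt_univ, dotProduct_lyapunov] at h

lemma IsHurwitz.tendsto_bilin {K : Matrix (Fin n) (Fin n) ℝ} (hK : IsHurwitz K)
    (X : Matrix (Fin n) (Fin n) ℝ) (w v : Fin n → ℝ) :
    Tendsto (fun t : ℝ => (NormedSpace.exp (t • K) *ᵥ w) ⬝ᵥ X *ᵥ (NormedSpace.exp (t • K) *ᵥ v))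
      atTop (𝓝 0) := by
  have hc : Continuous fun p : (Fin n → ℝ) × (Fin n → ℝ) => p.1 ⬝ᵥ X *ᵥ p.2 :=
    continuous_fst.dotProduct (continuous_const.matrix_mulVec continuous_snd)
  have h := (hc.tendsto (0, 0)).comp
    ((hK.tendsto_exp_smul_mulVec w).prodMk_nhds (hK.tendsto_exp_smul_mulVec v))
  rw [Matrix.mulVec_zero, dotProduct_zero] at h
  exact h

/-- The form `X` is constant along pairs of trajectories of `K`, and these tend to zero. -/
lemma IsHurwitz.eq_zero_of_lyapunov {K X : Matrix (Fin n) (Fin n) ℝ} (hK : IsHurwitz K)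
    (h : Kᵀ * X + X * K = 0) : X = 0 := by
  have key : ∀ w v : Fin n → ℝ, w ⬝ᵥ X *ᵥ v = 0 := by
    intro w v
    have hd := hasDerivAt_lyapunov K X w v
    simp only [h, Matrix.zero_mulVec, dotProduct_zero] at hd
    have hconst := is_const_of_deriv_eq_zero (fun t => (hd t).differentiableAt)
      (fun t => (hd t).deriv)
    have h0 := hK.tendsto_bilin X w v
    have h1 := tendsto_nhds_unique
      ((tendsto_const_nhds).congr fun t => hconst 0 t) h0
    simpa using h1
  ext i j
  simpa [Matrix.mulVec_single_one, Matrix.col] using key (Pi.single i 1) (Pi.single j 1)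

lemma antitone_lyapunov {K X Q : Matrix (Fin n) (Fin n) ℝ}
    (h : Kᵀ * X + X * K = -Q) (hQ : ∀ v, 0 ≤ v ⬝ᵥ Q *ᵥ v) (v : Fin n → ℝ) :
    Antitone
      (fun t : ℝ => (NormedSpace.exp (t • K) *ᵥ v) ⬝ᵥ X *ᵥ (NormedSpace.exp (t • K) *ᵥ v)) := by
  have hd := hasDerivAt_lyapunov K X v v
  refine antitone_of_deriv_nonpos (fun t => (hd t).differentiableAt) fun t => ?_
  rw [(hd t).deriv, h, Matrix.neg_mulVec, dotProduct_neg]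
  linarith [hQ (NormedSpace.exp (t • K) *ᵥ v)]

lemma IsHurwitz.lyapunov_nonneg {K X Q : Matrix (Fin n) (Fin n) ℝ} (hK : IsHurwitz K)
    (h : Kᵀ * X + X * K = -Q) (hQ : ∀ v, 0 ≤ v ⬝ᵥ Q *ᵥ v) (v : Fin n → ℝ) :
    0 ≤ v ⬝ᵥ X *ᵥ v := by
  have := (antitone_lyapunov h hQ v).le_of_tendsto (hK.tendsto_bilin X v v) 0
  simpa using this

lemma IsHurwitz.lyapunov_eq_zero {K X Q : Matrix (Fin n) (Fin n) ℝ} (hK : IsHurwitz K)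
    (h : Kᵀ * X + X * K = -Q) (hQ : ∀ v, 0 ≤ v ⬝ᵥ Q *ᵥ v) {v : Fin n → ℝ}
    (hv : v ⬝ᵥ X *ᵥ v = 0) {t : ℝ} (ht : 0 ≤ t) :
    (NormedSpace.exp (t • K) *ᵥ v) ⬝ᵥ Q *ᵥ (NormedSpace.exp (t • K) *ᵥ v) = 0 := by
  have hanti := antitone_lyapunov h hQ v
  have hz : ∀ s ∈ Ici t,
      (NormedSpace.exp (s • K) *ᵥ v) ⬝ᵥ X *ᵥ (NormedSpace.exp (s • K) *ᵥ v) = 0 := by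
    intro s hs
    refine le_antisymm ?_ (hK.lyapunov_nonneg h hQ _)
    have := hanti (ht.trans hs)
    simpa [hv] using this
  -- The form is known to vanish only for nonnegative times, and `t` may be `0`, so the right
  -- derivative is compared.
  have hd := (hasDerivAt_lyapunov K X v v t).hasDerivWithinAt (s := Ici t)
  have hd0 := (hasDerivWithinAt_const t (Ici t) (0 : ℝ)).congr hz (hz t self_mem_Ici)
  have := (uniqueDiffWithinAt_Ici t).eq_deriv _ hd hd0
  rw [h, Matrix.neg_mulVec, dotProduct_neg] at this
  linarith

/-- The adjoint trajectory `e^{-tAᵀ} v` has constant pairing with any controlled trajectory, since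
the input is invisible to it. Steering `v` to `0` gives `v ⬝ᵥ v = 0`. -/
lemma Controllable.eq_zero {A : Matrix (Fin n) (Fin n) ℝ} {B : Matrix (Fin n) (Fin m) ℝ}
    (hc : Controllable A B) {v : Fin n → ℝ}
    (hv : ∀ t : ℝ, 0 ≤ t → Bᵀ *ᵥ (NormedSpace.exp (t • -Aᵀ) *ᵥ v) = 0) : v = 0 := by
  obtain ⟨T, hT, x, u, -, hx, hx0, hxT⟩ := hc v 0
  have hd : ∀ t ∈ Icc 0 T,
      HasDerivWithinAt (fun t => (NormedSpace.exp (t • -Aᵀ) *ᵥ v) ⬝ᵥ x t) 0 (Icc 0 T) t := by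
    intro t ht
    have h := hasDerivWithinAt_dotProduct
      (hasDerivAt_exp_smul_mulVec_const (-Aᵀ) v t).hasDerivWithinAt (hx t ht)
    convert h using 1
    rw [dotProduct_add, Matrix.dotProduct_mulVec _ A, Matrix.dotProduct_mulVec _ B,
      ← Matrix.mulVec_transpose, ← Matrix.mulVec_transpose, hv t ht.1, Matrix.neg_mulVec]
    simp
  have h := constant_of_derivWithin_zero (fun t ht => (hd t ht).differentiableWithinAt)
    (fun t ht => (hd t (Ico_subset_Icc_self ht)).derivWithin
      (uniqueDiffOn_Icc hT t (Ico_subset_Icc_self ht))) T (right_mem_Icc.2 hT.le)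
  simp only [hx0, hxT, dotProduct_zero, zero_smul, NormedSpace.exp_zero, Matrix.one_mulVec] at h
  exact dotProduct_self_eq_zero.1 h.symm

lemma exp_smul_one_real (c : ℝ) :
    NormedSpace.exp (c • (1 : Matrix (Fin n) (Fin n) ℝ)) = Real.exp c • 1 := by
  rw [Matrix.smul_one_eq_diagonal, Matrix.smul_one_eq_diagonal, Matrix.exp_diagonal]
  congr 1
  ext i
  rw [Pi.coe_exp, Real.exp_eq_exp_ℝ]

lemma exp_shifted_mulVec (A : Matrix (Fin n) (Fin n) ℝ) (γ t : ℝ) (v : Fin n → ℝ) :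
    NormedSpace.exp (t • -(A + (γ / 2) • 1)) *ᵥ v =
      Real.exp (-(t * (γ / 2))) • (NormedSpace.exp (t • -A) *ᵥ v) := by
  have h : t • -(A + (γ / 2) • 1) =
      (-(t * (γ / 2))) • (1 : Matrix (Fin n) (Fin n) ℝ) + t • -A := by
    rw [neg_add, smul_add, ← neg_smul, smul_smul, mul_neg, add_comm]
  rw [h, Matrix.exp_add_of_commute _ _ ((Commute.one_left _).smul_left _), exp_smul_one_real,
    smul_mul_assoc, one_mul, Matrix.smul_mulVec]

lemma shifted_lyapunov_eq (A W : Matrix (Fin n) (Fin n) ℝ) (γ : ℝ) :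
    (-(Aᵀ + (γ / 2) • 1))ᵀ * W + W * -(Aᵀ + (γ / 2) • 1) = -(A * W + W * Aᵀ + γ • W) := by
  have h : γ • W = (γ / 2) • W + (γ / 2) • W := by rw [← add_smul, add_halves]
  rw [h]
  simp only [Matrix.transpose_neg, Matrix.transpose_add, Matrix.transpose_transpose,
    Matrix.transpose_smul, Matrix.transpose_one, neg_mul, mul_neg, add_mul, mul_add,
    smul_mul_assoc, one_mul, mul_smul_comm, mul_one]
  abel

lemma dotProduct_mul_transpose_self (B : Matrix (Fin n) (Fin m) ℝ) (v : Fin n → ℝ) :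
    v ⬝ᵥ (B * Bᵀ) *ᵥ v = (Bᵀ *ᵥ v) ⬝ᵥ (Bᵀ *ᵥ v) := by
  rw [← Matrix.mulVec_mulVec, Matrix.dotProduct_mulVec, Matrix.mulVec_transpose]

lemma dotProduct_mul_transpose_self_nonneg (B : Matrix (Fin n) (Fin m) ℝ) (v : Fin n → ℝ) :
    0 ≤ v ⬝ᵥ (B * Bᵀ) *ᵥ v := by
  rw [dotProduct_mul_transpose_self]
  exact Finset.sum_nonneg fun i _ => mul_self_nonneg _

lemma lyapunov_unique {A : Matrix (Fin n) (Fin n) ℝ} (hA : EigenvaluesImaginary A)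
    {γ : ℝ} (hγ : 0 < γ) {W₁ W₂ Q : Matrix (Fin n) (Fin n) ℝ}
    (h₁ : A * W₁ + W₁ * Aᵀ + γ • W₁ = Q) (h₂ : A * W₂ + W₂ * Aᵀ + γ • W₂ = Q) : W₁ = W₂ := by
  rw [← sub_eq_zero]
  refine (hA.isHurwitz hγ).eq_zero_of_lyapunov ?_
  rw [shifted_lyapunov_eq, neg_eq_zero, ← sub_eq_zero.2 (h₁.trans h₂.symm)]
  simp only [mul_sub, sub_mul, smul_sub]
  abel

lemma exists_posDef_lyapunov {A : Matrix (Fin n) (Fin n) ℝ} {B : Matrix (Fin n) (Fin m) ℝ}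
    (hc : Controllable A B) (hA : EigenvaluesImaginary A) {γ : ℝ} (hγ : 0 < γ) :
    ∃ W : Matrix (Fin n) (Fin n) ℝ, W.PosDef ∧ A * W + W * Aᵀ + γ • W = B * Bᵀ := by
  set K : Matrix (Fin n) (Fin n) ℝ := -(Aᵀ + (γ / 2) • 1) with hKdef
  have hK : IsHurwitz K := hA.isHurwitz hγ
  let L : Matrix (Fin n) (Fin n) ℝ →ₗ[ℝ] Matrix (Fin n) (Fin n) ℝ :=
    LinearMap.mulLeft ℝ Kᵀ + LinearMap.mulRight ℝ K
  -- In finite dimension, uniqueness for the homogeneous equation already gives solvability.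
  have hL : Function.Injective L :=
    (injective_iff_map_eq_zero L).2 fun X hX => hK.eq_zero_of_lyapunov hX
  obtain ⟨W, hW⟩ := LinearMap.injective_iff_surjective.1 hL (-(B * Bᵀ))
  have hW1 : Kᵀ * W + W * K = -(B * Bᵀ) := hW
  have hW2 : A * W + W * Aᵀ + γ • W = B * Bᵀ := by
    rw [hKdef, shifted_lyapunov_eq] at hW1
    exact neg_injective hW1
  have hsymm : Wᵀ = W := by
    refine lyapunov_unique hA hγ ?_ hW2
    have := congrArg Matrix.transpose hW2
    simp only [Matrix.transpose_add, Matrix.transpose_mul, Matrix.transpose_transpose,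
      Matrix.transpose_smul] at this
    rw [← this]
    abel
  refine ⟨W, Matrix.PosDef.of_dotProduct_mulVec_pos ?_ fun v hv => ?_, hW2⟩
  · rw [Matrix.IsHermitian, Matrix.conjTranspose_eq_transpose_of_trivial, hsymm]
  rw [star_trivial]
  have hQ := dotProduct_mul_transpose_self_nonneg B
  refine lt_of_le_of_ne (hK.lyapunov_nonneg hW1 hQ v) fun h0 => hv ?_
  refine hc.eq_zero fun t ht => ?_
  have h := hK.lyapunov_eq_zero hW1 hQ h0.symm ht
  rw [dotProduct_mul_transpose_self, dotProduct_self_eq_zero, hKdef, exp_shifted_mulVec,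
    Matrix.mulVec_smul] at h
  exact (smul_eq_zero.1 h).resolve_left (Real.exp_pos _).ne'

/-! ### The Riccati equation through its inverse. -/

lemma IsRiccatiSolution.inv_lyapunov {A : Matrix (Fin n) (Fin n) ℝ} {B : Matrix (Fin n) (Fin m) ℝ}
    {γ : ℝ} {P : Matrix (Fin n) (Fin n) ℝ} (h : IsRiccatiSolution A B γ P) :
    A * P⁻¹ + P⁻¹ * Aᵀ + γ • P⁻¹ = B * Bᵀ := by
  obtain ⟨hP, hE⟩ := h
  have hu : IsUnit P.det := (Matrix.isUnit_iff_isUnit_det _).1 hP.isUnit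
  have h1 := Matrix.mul_nonsing_inv P hu
  have h2 := Matrix.nonsing_inv_mul P hu
  have h3 := congrArg (fun X => P⁻¹ * X * P⁻¹) hE
  have e1 : P⁻¹ * (Aᵀ * P) * P⁻¹ = P⁻¹ * Aᵀ := by
    rw [← mul_assoc, mul_assoc, h1, mul_one]
  have e2 : P⁻¹ * (P * A) * P⁻¹ = A * P⁻¹ := by rw [← mul_assoc, h2, one_mul]
  have e3 : P⁻¹ * (P * B * Bᵀ * P) * P⁻¹ = B * Bᵀ := by
    simp only [← Matrix.mul_assoc]
    rw [h2, Matrix.one_mul, Matrix.mul_assoc, h1, Matrix.mul_one]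
  have e4 : P⁻¹ * (γ • P) * P⁻¹ = γ • P⁻¹ := by
    rw [mul_smul_comm, smul_mul_assoc, h2, one_mul]
  simp only [mul_sub, mul_add, sub_mul, add_mul, mul_neg, neg_mul, e1, e2, e3, e4] at h3
  rw [sub_eq_iff_eq_add] at h3
  rw [add_comm (A * P⁻¹), h3]
  abel

lemma isRiccatiSolution_inv {A : Matrix (Fin n) (Fin n) ℝ} {B : Matrix (Fin n) (Fin m) ℝ}
    {γ : ℝ} {W : Matrix (Fin n) (Fin n) ℝ} (hW : W.PosDef)
    (hE : A * W + W * Aᵀ + γ • W = B * Bᵀ) : IsRiccatiSolution A B γ W⁻¹ := by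
  refine ⟨hW.inv, ?_⟩
  have hu : IsUnit W.det := (Matrix.isUnit_iff_isUnit_det _).1 hW.isUnit
  have h1 := Matrix.mul_nonsing_inv W hu
  have h2 := Matrix.nonsing_inv_mul W hu
  have e : W⁻¹ * B * Bᵀ * W⁻¹ = W⁻¹ * (A * W + W * Aᵀ + γ • W) * W⁻¹ := by
    rw [hE]; simp only [Matrix.mul_assoc]
  have e1 : W⁻¹ * (A * W) * W⁻¹ = W⁻¹ * A := by rw [← mul_assoc, mul_assoc, h1, mul_one]
  have e2 : W⁻¹ * (W * Aᵀ) * W⁻¹ = Aᵀ * W⁻¹ := by rw [← mul_assoc, h2, one_mul]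
  have e3 : W⁻¹ * (γ • W) * W⁻¹ = γ • W⁻¹ := by
    rw [mul_smul_comm, smul_mul_assoc, h2, one_mul]
  rw [e]
  simp only [mul_add, add_mul, e1, e2, e3]
  abel

lemma IsRiccatiSolution.unique {A : Matrix (Fin n) (Fin n) ℝ} {B : Matrix (Fin n) (Fin m) ℝ}
    (hA : EigenvaluesImaginary A) {γ : ℝ} (hγ : 0 < γ) {P₁ P₂ : Matrix (Fin n) (Fin n) ℝ}
    (h₁ : IsRiccatiSolution A B γ P₁) (h₂ : IsRiccatiSolution A B γ P₂) : P₁ = P₂ := by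
  have h := lyapunov_unique hA hγ h₁.inv_lyapunov h₂.inv_lyapunov
  rw [← Matrix.nonsing_inv_nonsing_inv P₁ ((Matrix.isUnit_iff_isUnit_det _).1 h₁.1.isUnit), h,
    Matrix.nonsing_inv_nonsing_inv P₂ ((Matrix.isUnit_iff_isUnit_det _).1 h₂.1.isUnit)]

lemma existsUnique_isRiccatiSolution {A : Matrix (Fin n) (Fin n) ℝ}
    {B : Matrix (Fin n) (Fin m) ℝ} (hc : Controllable A B) (hA : EigenvaluesImaginary A)
    {γ : ℝ} (hγ : 0 < γ) : ∃! P : Matrix (Fin n) (Fin n) ℝ, IsRiccatiSolution A B γ P := by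
  obtain ⟨W, hW, hE⟩ := exists_posDef_lyapunov hc hA hγ
  exact ⟨W⁻¹, isRiccatiSolution_inv hW hE, fun P hP => hP.unique hA hγ (isRiccatiSolution_inv hW hE)⟩

/-! ### The norm defined by `P` and the low-gain estimates. -/

open scoped MatrixOrder in
/-- A positive semidefinite matrix is the Gram form of a linear map into Euclidean space. -/
lemma exists_gram_map {P : Matrix (Fin n) (Fin n) ℝ} (hP : P.PosSemidef) :
    ∃ l : (Fin n → ℝ) →L[ℝ] EuclideanSpace ℝ (Fin n),
      ∀ x y, inner ℝ (l x) (l y) = x ⬝ᵥ P *ᵥ y := by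
  obtain ⟨C, hC⟩ := CStarAlgebra.nonneg_iff_eq_star_mul_self.mp hP.nonneg
  refine ⟨(EuclideanSpace.equiv (Fin n) ℝ).symm.toContinuousLinearMap.comp
    (Matrix.mulVecLin C).toContinuousLinearMap, fun x y => ?_⟩
  rw [hC, Matrix.star_eq_conjTranspose, Matrix.conjTranspose_eq_transpose_of_trivial,
    ← Matrix.mulVec_mulVec, Matrix.dotProduct_mulVec, Matrix.vecMul_transpose, dotProduct_comm]
  rfl

section Gram

variable {P : Matrix (Fin n) (Fin n) ℝ} {l : (Fin n → ℝ) →L[ℝ] EuclideanSpace ℝ (Fin n)}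

lemma norm_sq_gram (hl : ∀ x y, inner ℝ (l x) (l y) = x ⬝ᵥ P *ᵥ y) (x : Fin n → ℝ) :
    ‖l x‖ ^ 2 = x ⬝ᵥ P *ᵥ x := by
  rw [← hl, real_inner_self_eq_norm_sq]

lemma exists_norm_le_gram (hP : P.PosDef) (hl : ∀ x y, inner ℝ (l x) (l y) = x ⬝ᵥ P *ᵥ y) :
    ∃ k : ℝ, 0 < k ∧ ∀ x, ‖x‖ ≤ k * ‖l x‖ := by
  have hker : LinearMap.ker (l : (Fin n → ℝ) →ₗ[ℝ] EuclideanSpace ℝ (Fin n)) = ⊥ := by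
    refine LinearMap.ker_eq_bot'.2 fun x hx => ?_
    by_contra hne
    have h := hP.dotProduct_mulVec_pos hne
    rw [star_trivial, ← norm_sq_gram hl, show l x = 0 from hx] at h
    simp at h
  obtain ⟨k, hk, h⟩ := LinearMap.exists_antilipschitzWith _ hker
  refine ⟨k, hk, fun x => ?_⟩
  simpa using h.le_mul_dist x 0

end Gram

lemma IsRiccatiSolution.dotProduct_le {A : Matrix (Fin n) (Fin n) ℝ}
    {B : Matrix (Fin n) (Fin m) ℝ} (hA : EigenvaluesImaginary A) {γ : ℝ} (hγ : 0 < γ)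
    (hγ1 : γ ≤ 1) {P P₁ : Matrix (Fin n) (Fin n) ℝ} (h : IsRiccatiSolution A B γ P)
    (h₁ : IsRiccatiSolution A B 1 P₁) (z : Fin n → ℝ) : z ⬝ᵥ P *ᵥ z ≤ z ⬝ᵥ P₁ *ᵥ z := by
  have hmono : ∀ v, v ⬝ᵥ P₁⁻¹ *ᵥ v ≤ v ⬝ᵥ P⁻¹ *ᵥ v := by
    intro v
    -- Subtracting the two inverse equations leaves a Lyapunov equation with source `(1 - γ) P₁⁻¹ ≥
    -- 0`.
    have key := (hA.isHurwitz hγ).lyapunov_nonneg (X := P⁻¹ - P₁⁻¹) (Q := (1 - γ) • P₁⁻¹) ?_ ?_ v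
    · rwa [Matrix.sub_mulVec, dotProduct_sub, sub_nonneg] at key
    · rw [shifted_lyapunov_eq, neg_inj]
      have e := h.inv_lyapunov.trans h₁.inv_lyapunov.symm
      simp only [mul_sub, sub_mul, smul_sub, sub_smul] at e ⊢
      rw [one_smul] at e ⊢
      rw [← sub_eq_zero] at e ⊢
      rw [← e]
      abel
    · intro w
      rw [Matrix.smul_mulVec, dotProduct_smul, smul_eq_mul]
      exact mul_nonneg (by linarith)
        (by simpa using h₁.1.inv.posSemidef.dotProduct_mulVec_nonneg w)
  obtain ⟨l, hl⟩ := exists_gram_map h₁.1.inv.posSemidef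
  have hu : IsUnit P.det := (Matrix.isUnit_iff_isUnit_det _).1 h.1.isUnit
  have hu₁ : IsUnit P₁.det := (Matrix.isUnit_iff_isUnit_det _).1 h₁.1.isUnit
  -- Inversion reverses the order: by Cauchy–Schwarz for `P₁⁻¹`, `(zᵀPz)² ≤ (Pz)ᵀP₁⁻¹(Pz) · zᵀP₁z`,
  -- and the first factor is at most `zᵀPz`.
  have hcs := real_inner_mul_inner_self_le (l (P *ᵥ z)) (l (P₁ *ᵥ z))
  have e : P₁⁻¹ *ᵥ (P₁ *ᵥ z) = z := by
    rw [Matrix.mulVec_mulVec, Matrix.nonsing_inv_mul _ hu₁, Matrix.one_mulVec]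
  have e' : P⁻¹ *ᵥ (P *ᵥ z) = z := by
    rw [Matrix.mulVec_mulVec, Matrix.nonsing_inv_mul _ hu, Matrix.one_mulVec]
  have hm := hmono (P *ᵥ z)
  rw [e'] at hm
  simp only [hl, e] at hcs
  rw [dotProduct_comm (P *ᵥ z) z] at hcs hm
  rw [dotProduct_comm (P₁ *ᵥ z) z] at hcs
  have h0 : 0 ≤ z ⬝ᵥ P *ᵥ z := by simpa using h.1.posSemidef.dotProduct_mulVec_nonneg z
  have h10 : 0 ≤ z ⬝ᵥ P₁ *ᵥ z := by simpa using h₁.1.posSemidef.dotProduct_mulVec_nonneg z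
  rcases h0.eq_or_lt with h0 | h0
  · rw [← h0]; exact h10
  · exact le_of_mul_le_mul_left (hcs.trans (mul_le_mul_of_nonneg_right hm h10)) h0

lemma IsRiccatiSolution.lyapunov_quadForm {A : Matrix (Fin n) (Fin n) ℝ}
    {B : Matrix (Fin n) (Fin m) ℝ} {γ : ℝ} {P : Matrix (Fin n) (Fin n) ℝ}
    (h : IsRiccatiSolution A B γ P) (z : Fin n → ℝ) :
    (A *ᵥ z) ⬝ᵥ P *ᵥ z + z ⬝ᵥ P *ᵥ (A *ᵥ z) =
      -(γ * (z ⬝ᵥ P *ᵥ z)) + (Bᵀ *ᵥ (P *ᵥ z)) ⬝ᵥ (Bᵀ *ᵥ (P *ᵥ z)) := by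
  have hPt : Pᵀ = P := by
    rw [← Matrix.conjTranspose_eq_transpose_of_trivial]; exact h.1.isHermitian
  have e : Aᵀ * P + P * A = -(γ • P) + P * (B * Bᵀ) * P := by
    rw [← h.2, sub_eq_add_neg, add_assoc]
    simp only [Matrix.mul_assoc, neg_add_cancel, add_zero]
  have e2 : z ⬝ᵥ (P * (B * Bᵀ) * P) *ᵥ z = (P *ᵥ z) ⬝ᵥ (B * Bᵀ) *ᵥ (P *ᵥ z) := by
    rw [← Matrix.mulVec_mulVec, ← Matrix.mulVec_mulVec, Matrix.dotProduct_mulVec z P,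
      ← Matrix.mulVec_transpose, hPt]
  rw [dotProduct_lyapunov, e, Matrix.add_mulVec, dotProduct_add, e2,
    dotProduct_mul_transpose_self, Matrix.neg_mulVec, dotProduct_neg, Matrix.smul_mulVec,
    dotProduct_smul, smul_eq_mul]

/-- Completion of the square in `u`: only the deviation of `u` from the ideal feedback `-Bᵀ P z` can
slow the decay. -/
lemma IsRiccatiSolution.controlled_quadForm {A : Matrix (Fin n) (Fin n) ℝ}
    {B : Matrix (Fin n) (Fin m) ℝ} {γ : ℝ} {P : Matrix (Fin n) (Fin n) ℝ}
    (h : IsRiccatiSolution A B γ P) (z : Fin n → ℝ) (u : Fin m → ℝ) :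
    (A *ᵥ z + B *ᵥ u) ⬝ᵥ P *ᵥ z + z ⬝ᵥ P *ᵥ (A *ᵥ z + B *ᵥ u) =
      -(γ * (z ⬝ᵥ P *ᵥ z)) + (u + Bᵀ *ᵥ (P *ᵥ z)) ⬝ᵥ (u + Bᵀ *ᵥ (P *ᵥ z)) - u ⬝ᵥ u := by
  have hPt : Pᵀ = P := by
    rw [← Matrix.conjTranspose_eq_transpose_of_trivial]; exact h.1.isHermitian
  have e1 : (B *ᵥ u) ⬝ᵥ P *ᵥ z = u ⬝ᵥ Bᵀ *ᵥ (P *ᵥ z) := by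
    rw [Matrix.dotProduct_mulVec u, Matrix.vecMul_transpose]
  have e2 : z ⬝ᵥ P *ᵥ (B *ᵥ u) = u ⬝ᵥ Bᵀ *ᵥ (P *ᵥ z) := by
    rw [Matrix.dotProduct_mulVec, ← Matrix.mulVec_transpose, hPt, dotProduct_comm, e1]
  have := h.lyapunov_quadForm z
  simp only [add_dotProduct, dotProduct_add, Matrix.mulVec_add, e1, e2,
    dotProduct_comm (Bᵀ *ᵥ (P *ᵥ z)) u]
  linarith

lemma IsRiccatiSolution.trace_eq {A : Matrix (Fin n) (Fin n) ℝ}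
    {B : Matrix (Fin n) (Fin m) ℝ} (hA : EigenvaluesImaginary A) {γ : ℝ}
    {P : Matrix (Fin n) (Fin n) ℝ} (h : IsRiccatiSolution A B γ P) :
    (Bᵀ * P * B).trace = n * γ := by
  have hu : IsUnit P.det := (Matrix.isUnit_iff_isUnit_det _).1 h.1.isUnit
  have h2 := Matrix.nonsing_inv_mul P hu
  have h1 := Matrix.mul_nonsing_inv P hu
  rw [Matrix.trace_mul_comm, ← Matrix.mul_assoc, ← h.inv_lyapunov, add_mul, add_mul,
    Matrix.trace_add, Matrix.trace_add, mul_assoc A, h2, mul_one, Matrix.trace_mul_comm,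
    ← mul_assoc P, h1, one_mul, Matrix.trace_transpose, hA.trace_eq_zero, smul_mul_assoc, h2,
    Matrix.trace_smul, Matrix.trace_one]
  simp [mul_comm]

/-- The low-gain estimate `|Bᵀ P z|² ≤ n γ zᵀ P z`. -/
lemma IsRiccatiSolution.feedback_sq_le {A : Matrix (Fin n) (Fin n) ℝ}
    {B : Matrix (Fin n) (Fin m) ℝ} (hA : EigenvaluesImaginary A) {γ : ℝ}
    {P : Matrix (Fin n) (Fin n) ℝ} (h : IsRiccatiSolution A B γ P) (z : Fin n → ℝ) :
    (Bᵀ *ᵥ (P *ᵥ z)) ⬝ᵥ (Bᵀ *ᵥ (P *ᵥ z)) ≤ n * γ * (z ⬝ᵥ P *ᵥ z) := by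
  obtain ⟨l, hl⟩ := exists_gram_map h.1.posSemidef
  rw [← h.trace_eq hA, Matrix.trace, Finset.sum_mul]
  refine Finset.sum_le_sum fun j _ => ?_
  -- Cauchy–Schwarz in the norm of `P`, column by column of `B`; the squared column norms add up to
  -- the trace.
  have hcs := real_inner_mul_inner_self_le (l (B.col j)) (l z)
  simp only [hl] at hcs
  have e : (Bᵀ * P * B).diag j = B.col j ⬝ᵥ P *ᵥ B.col j := by
    rw [Matrix.mul_assoc, Matrix.diag_apply, Matrix.mul_apply_eq_vecMul]
    rfl
  rw [e]
  exact hcs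

/-! ### Scalar decay with delay. -/

lemma le_of_hasDerivWithinAt_le_mul_sub {f f' : ℝ → ℝ} {k D T₀ T₁ : ℝ} (hT : T₀ ≤ T₁)
    (hf : ∀ t ∈ Icc T₀ T₁, HasDerivWithinAt f (f' t) (Icc T₀ T₁) t)
    (hle : ∀ t ∈ Icc T₀ T₁, f' t ≤ k * (f t - D)) :
    f T₁ ≤ D + Real.exp (k * (T₁ - T₀)) * (f T₀ - D) := by
  have hd : ∀ t ∈ Icc T₀ T₁, HasDerivWithinAt (fun t => Real.exp (-(k * (t - T₀))) * (f t - D))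
      (Real.exp (-(k * (t - T₀))) * (f' t - k * (f t - D))) (Icc T₀ T₁) t := by
    intro t ht
    have h1 : HasDerivAt (fun t => Real.exp (-(k * (t - T₀))))
        (Real.exp (-(k * (t - T₀))) * -(k * 1)) t :=
      ((((hasDerivAt_id t).sub_const T₀).const_mul k).neg).exp
    refine (h1.hasDerivWithinAt.mul ((hf t ht).sub_const D)).congr_deriv ?_
    ring
  have hanti := antitoneOn_of_hasDerivWithinAt_nonpos (convex_Icc T₀ T₁)
    (fun t ht => (hd t ht).continuousWithinAt)
    (fun t ht => (hd t (interior_subset ht)).mono interior_subset)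
    (fun t ht => mul_nonpos_of_nonneg_of_nonpos (Real.exp_pos _).le
      (sub_nonpos.2 (hle t (interior_subset ht))))
  have h := hanti (left_mem_Icc.2 hT) (right_mem_Icc.2 hT) hT
  simp only [sub_self, mul_zero, neg_zero, Real.exp_zero, one_mul] at h
  have h2 := mul_le_mul_of_nonneg_left h (Real.exp_pos (k * (T₁ - T₀))).le
  rw [← mul_assoc, ← Real.exp_add, add_neg_cancel, Real.exp_zero, one_mul] at h2
  linarith

/-- A pair `a`, `b` of nonnegative functions for which `b²` decays up to a small multiple of the
recent maximum of `a²`, while `a` and `b` differ by a small multiple of that maximum. -/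
structure DelayDecay (a b : ℝ → ℝ) (r γ ε : ℝ) : Prop where
  rate_pos : 0 < γ
  delay_nonneg : 0 ≤ r
  eps_nonneg : 0 ≤ ε
  eps_le : ε ≤ 1 / 4
  continuousOn : ContinuousOn a (Ici (-r))
  left_nonneg : ∀ t, 0 ≤ a t
  right_nonneg : ∀ t, 0 ≤ b t
  abs_sub_le : ∀ t, 0 ≤ t → ∀ M, (∀ s ∈ Icc (t - r) t, a s ≤ M) → |a t - b t| ≤ ε * M
  hasDeriv : ∃ V' : ℝ → ℝ, ∀ t, 0 ≤ t → HasDerivWithinAt (fun t => b t ^ 2) (V' t) (Ici 0) t ∧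
    ∀ M, (∀ s ∈ Icc (t - r) t, a s ≤ M) → V' t ≤ -γ * (b t ^ 2 - (ε * M) ^ 2)

namespace DelayDecay

variable {a b : ℝ → ℝ} {r γ ε : ℝ}

lemma sq_le (h : DelayDecay a b r γ ε) {T₀ T₁ M : ℝ} (h0 : 0 ≤ T₀) (h1 : T₀ ≤ T₁)
    (hM : ∀ s ∈ Icc (T₀ - r) T₁, a s ≤ M) :
    b T₁ ^ 2 ≤ (ε * M) ^ 2 + Real.exp (-γ * (T₁ - T₀)) * b T₀ ^ 2 := by
  obtain ⟨V', hV⟩ := h.hasDeriv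
  have key := le_of_hasDerivWithinAt_le_mul_sub (k := -γ) (D := (ε * M) ^ 2) h1
    (fun t ht => ((hV t (h0.trans ht.1)).1).mono fun s hs => h0.trans hs.1)
    (fun t ht => (hV t (h0.trans ht.1)).2 M fun s hs =>
      hM s ⟨by linarith [hs.1, ht.1], hs.2.trans ht.2⟩)
  refine key.trans ?_
  have := mul_nonneg (Real.exp_pos (-γ * (T₁ - T₀))).le (sq_nonneg (ε * M))
  linarith

lemma bounded (h : DelayDecay a b r γ ε) {S₀ : ℝ} (hS : ∀ s ∈ Icc (-r) 0, a s ≤ S₀) {t : ℝ}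
    (ht : 0 ≤ t) : a t ≤ 4 * S₀ := by
  have hr := h.delay_nonneg
  have hε := h.eps_nonneg
  have hε4 := h.eps_le
  -- At a maximum point `p > 0` of `a`, the estimates give `a p ≤ 2 ε a p + 2 S₀ ≤ a p / 2 + 2 S₀`.
  obtain ⟨p, hp, hmax⟩ := isCompact_Icc.exists_isMaxOn (s := Icc (-r) t)
    ⟨t, by linarith, le_rfl⟩ (h.continuousOn.mono fun s hs => hs.1)
  have hmax' : ∀ s ∈ Icc (-r) t, a s ≤ a p := fun s hs => hmax hs
  have hS0 : 0 ≤ S₀ := (h.left_nonneg 0).trans (hS 0 ⟨by linarith, le_rfl⟩)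
  refine (hmax' t ⟨by linarith, le_rfl⟩).trans ?_
  rcases le_total p 0 with hp0 | hp0
  · linarith [hS p ⟨hp.1, hp0⟩]
  have hb0 : b 0 ≤ 2 * S₀ := by
    have h1 := abs_le.1 (h.abs_sub_le 0 le_rfl S₀ (by simpa using hS))
    have h2 := hS 0 ⟨by linarith, le_rfl⟩
    nlinarith
  have hb := h.sq_le (T₀ := 0) (T₁ := p) (M := a p) le_rfl hp0
    fun s hs => hmax' s ⟨by linarith [hs.1], hs.2.trans hp.2⟩
  have hexp : Real.exp (-γ * (p - 0)) ≤ 1 := by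
    rw [Real.exp_le_one_iff]
    nlinarith [h.rate_pos]
  have hap := h.left_nonneg p
  have hb1 : b p ≤ ε * a p + 2 * S₀ := by
    refine abs_le_of_sq_le_sq' ?_ (by positivity) |>.2
    have h1 : Real.exp (-γ * (p - 0)) * b 0 ^ 2 ≤ 1 * (2 * S₀) ^ 2 :=
      mul_le_mul hexp (pow_le_pow_left₀ (h.right_nonneg 0) hb0 2) (sq_nonneg _) zero_le_one
    nlinarith [mul_nonneg (mul_nonneg hε hap) hS0]
  have h3 := abs_le.1 (h.abs_sub_le p hp0 (a p)
    fun s hs => hmax' s ⟨by linarith [hs.1], hs.2.trans hp.2⟩)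
  nlinarith

/-- Once the bound `M` holds on a whole delay window and the transient of `b²` is below `(M/4)²`,
one has `b ≤ M/2`, and `a` exceeds `b` by at most `M/4`. -/
lemma eventually_contract (h : DelayDecay a b r γ ε) {M : ℝ} (hM : 0 < M)
    (hev : ∀ᶠ t in atTop, a t ≤ M) : ∀ᶠ t in atTop, a t ≤ 3 / 4 * M := by
  have hr := h.delay_nonneg
  have hε := h.eps_nonneg
  have hε4 := h.eps_le
  have hγ := h.rate_pos
  obtain ⟨T, hT⟩ := eventually_atTop.1 hev
  set T₀ := max (T + r) 0
  have hT0 : 0 ≤ T₀ := le_max_right _ _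
  have hT1 : T ≤ T₀ - r := by linarith [le_max_left (T + r) 0]
  have hlim : Tendsto (fun t => Real.exp (-γ * (t - T₀)) * b T₀ ^ 2) atTop (𝓝 0) := by
    have h1 : Tendsto (fun t : ℝ => -γ * (t - T₀)) atTop atBot :=
      (tendsto_atTop_add_const_right _ (-T₀) tendsto_id).const_mul_atTop_of_neg (by linarith)
    simpa using (Real.tendsto_exp_atBot.comp h1).mul_const (b T₀ ^ 2)
  filter_upwards [hlim.eventually_le_const (show 0 < (M / 4) ^ 2 by positivity),
    eventually_ge_atTop T₀] with t ht1 ht2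
  have hb := h.sq_le hT0 ht2 fun s hs => hT s (hT1.trans hs.1)
  have hεM : ε * M ≤ M / 4 := by nlinarith
  have hb1 : b t ≤ M / 2 := by
    refine abs_le_of_sq_le_sq' ?_ (by positivity) |>.2
    have := pow_le_pow_left₀ (by positivity) hεM 2
    nlinarith
  have h3 := abs_le.1 (h.abs_sub_le t (hT0.trans ht2) M
    fun s hs => hT s (by linarith [hs.1]))
  linarith

lemma tendsto_zero (h : DelayDecay a b r γ ε) : Tendsto a atTop (𝓝 0) := by
  obtain ⟨p, -, hmax⟩ := isCompact_Icc.exists_isMaxOn (s := Icc (-r) 0)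
    ⟨0, by linarith [h.delay_nonneg], le_rfl⟩ (h.continuousOn.mono fun s hs => hs.1)
  have hp := h.left_nonneg p
  have hpow : ∀ k : ℕ, ∀ᶠ t in atTop, a t ≤ (3 / 4) ^ k * (4 * a p + 1) := by
    intro k
    induction k with
    | zero =>
      filter_upwards [eventually_ge_atTop 0] with t ht
      linarith [h.bounded (fun s hs => hmax hs) ht]
    | succ k ih =>
      rw [pow_succ', mul_assoc]
      exact h.eventually_contract (by positivity) ih
  have hlim : Tendsto (fun k : ℕ => (3 / 4 : ℝ) ^ k * (4 * a p + 1)) atTop (𝓝 0) := by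
    simpa using (tendsto_pow_atTop_nhds_zero_of_lt_one (r := (3 / 4 : ℝ)) (by norm_num)
      (by norm_num)).mul_const (4 * a p + 1)
  refine tendsto_order.2 ⟨fun c hc => Eventually.of_forall fun t => hc.trans_le (h.left_nonneg t),
    fun c hc => ?_⟩
  obtain ⟨k, hk⟩ := (hlim.eventually_lt_const hc).exists
  filter_upwards [hpow k] with t ht using ht.trans_lt hk

end DelayDecay

/-! ### The delay-free predictor and flow bounds in the norm of `P`. -/

lemma quadForm_exp_smul_le {P M : Matrix (Fin n) (Fin n) ℝ} {k : ℝ}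
    (h : ∀ z, (M *ᵥ z) ⬝ᵥ P *ᵥ z + z ⬝ᵥ P *ᵥ (M *ᵥ z) ≤ k * (z ⬝ᵥ P *ᵥ z)) {t : ℝ} (ht : 0 ≤ t)
    (z : Fin n → ℝ) :
    (NormedSpace.exp (t • M) *ᵥ z) ⬝ᵥ P *ᵥ (NormedSpace.exp (t • M) *ᵥ z) ≤
      Real.exp (k * t) * (z ⬝ᵥ P *ᵥ z) := by
  have hd : ∀ s, HasDerivAt (fun s : ℝ =>
      (NormedSpace.exp (s • M) *ᵥ z) ⬝ᵥ P *ᵥ (NormedSpace.exp (s • M) *ᵥ z)) _ s :=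
    fun s => hasDerivAt_lyapunov M P z z s
  have := le_of_hasDerivWithinAt_le_mul_sub (k := k) (D := 0) ht
    (fun s _ => (hd s).hasDerivWithinAt) (fun s _ => by
      rw [← dotProduct_lyapunov, sub_zero]; exact h _)
  simpa using this

lemma exp_smul_mulVec_add (A : Matrix (Fin n) (Fin n) ℝ) (s t : ℝ) (v : Fin n → ℝ) :
    NormedSpace.exp ((s + t) • A) *ᵥ v =
      NormedSpace.exp (s • A) *ᵥ (NormedSpace.exp (t • A) *ᵥ v) := by
  rw [Matrix.mulVec_mulVec, add_smul, ← Matrix.exp_add_of_commute]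
  exact ((Commute.refl A).smul_left s).smul_right t

/-- The part of the future state that is due to the input applied over `[t - τ, t]`. -/
noncomputable def pendingInput (A : Matrix (Fin n) (Fin n) ℝ) (b : Matrix (Fin n) (Fin m) ℝ)
    (τ : ℝ) (u : ℝ → Fin m → ℝ) (t : ℝ) : Fin n → ℝ :=
  NormedSpace.exp ((t - τ) • A) *ᵥ
    ((∫ s in (0 : ℝ)..t, NormedSpace.exp (s • -A) *ᵥ (b *ᵥ u s)) -
      ∫ s in (0 : ℝ)..(t - τ), NormedSpace.exp (s • -A) *ᵥ (b *ᵥ u s))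

lemma hasDerivAt_integral_exp (A : Matrix (Fin n) (Fin n) ℝ) (b : Matrix (Fin n) (Fin m) ℝ)
    {u : ℝ → Fin m → ℝ} (hu : Continuous u) (t : ℝ) :
    HasDerivAt (fun t => ∫ s in (0 : ℝ)..t, NormedSpace.exp (s • -A) *ᵥ (b *ᵥ u s))
      (NormedSpace.exp (t • -A) *ᵥ (b *ᵥ u t)) t := by
  have hE : Continuous fun s : ℝ => NormedSpace.exp (s • -A) :=
    continuous_pi fun i => continuous_pi fun j =>
      continuous_iff_continuousAt.2 fun s => (hasDerivAt_exp_smul_apply (-A) s i j).continuousAt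
  have hc : Continuous fun s : ℝ => NormedSpace.exp (s • -A) *ᵥ (b *ᵥ u s) :=
    hE.matrix_mulVec (continuous_const.matrix_mulVec hu)
  exact hc.integral_hasStrictDerivAt 0 t |>.hasDerivAt

/-- The term `-b u(t - τ)` cancels the delayed input in `ẋ`, replacing it by `e^{-Aτ} b u(t)`; this
is how the reduced input matrix arises. -/
lemma hasDerivAt_pendingInput (A : Matrix (Fin n) (Fin n) ℝ) (b : Matrix (Fin n) (Fin m) ℝ)
    (τ : ℝ) {u : ℝ → Fin m → ℝ} (hu : Continuous u) (t : ℝ) :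
    HasDerivAt (pendingInput A b τ u)
      (A *ᵥ pendingInput A b τ u t + (NormedSpace.exp (-(τ • A)) * b) *ᵥ u t -
        b *ᵥ u (t - τ)) t := by
  have hG := hasDerivAt_integral_exp A b hu
  have h1 := ((hG (t - τ + τ)).comp_add_const (t - τ) τ).fun_sub (hG (t - τ))
  have h2 := hasDerivWithinAt_exp_smul_mulVec (s := univ) A h1.hasDerivWithinAt
  rw [hasDerivWithinAt_univ] at h2
  have h3 := h2.comp_sub_const t τ
  simp only [sub_add_cancel] at h3
  refine h3.congr_deriv ?_
  rw [Matrix.mulVec_sub (NormedSpace.exp ((t - τ) • A)) (NormedSpace.exp (t • -A) *ᵥ _),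
    exp_smul_mulVec_neg]
  have e : NormedSpace.exp (t • -A) *ᵥ (b *ᵥ u t) = NormedSpace.exp ((t - τ) • -A) *ᵥ
      (NormedSpace.exp (τ • -A) *ᵥ (b *ᵥ u t)) := by
    rw [← exp_smul_mulVec_add, sub_add_cancel]
  rw [e, exp_smul_mulVec_neg, smul_neg,
    ← Matrix.mulVec_mulVec _ (NormedSpace.exp (-(τ • A))) b, add_sub_assoc]
  rfl

lemma norm_pendingInput_le {E : Type*} [NormedAddCommGroup E] [NormedSpace ℝ E]
    (l : (Fin n → ℝ) →L[ℝ] E) (A : Matrix (Fin n) (Fin n) ℝ) (b : Matrix (Fin n) (Fin m) ℝ)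
    {τ : ℝ} (hτ : 0 ≤ τ) {u : ℝ → Fin m → ℝ} (hu : Continuous u) (t : ℝ) {C : ℝ}
    (hC : ∀ s ∈ Icc (t - τ) t,
      ‖l (NormedSpace.exp ((s - (t - τ)) • -A) *ᵥ (b *ᵥ u s))‖ ≤ C) :
    ‖l (pendingInput A b τ u t)‖ ≤ C * τ := by
  have hd : ∀ s ∈ Icc (t - τ) t, HasDerivWithinAt
      (fun s => l (NormedSpace.exp ((t - τ) • A) *ᵥ
        ∫ r in (0 : ℝ)..s, NormedSpace.exp (r • -A) *ᵥ (b *ᵥ u r)))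
      (l (NormedSpace.exp ((s - (t - τ)) • -A) *ᵥ (b *ᵥ u s))) (Icc (t - τ) t) s := by
    intro s _
    have h1 := hasDerivWithinAt_mulVec (NormedSpace.exp ((t - τ) • A))
      (hasDerivAt_integral_exp A b hu s).hasDerivWithinAt (s := Icc (t - τ) t)
    have h2 := l.hasFDerivAt.comp_hasDerivWithinAt s h1
    refine h2.congr_deriv ?_
    have e := exp_smul_mulVec_add (-A) (t - τ) (s - (t - τ)) (b *ᵥ u s)
    rw [add_sub_cancel] at e
    rw [e, exp_smul_mulVec_neg]
  have h := (convex_Icc (t - τ) t).norm_image_sub_le_of_norm_hasDerivWithin_le hd hC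
    (left_mem_Icc.2 (by linarith)) (right_mem_Icc.2 (by linarith))
  rw [← map_sub, ← Matrix.mulVec_sub, sub_sub_cancel, Real.norm_of_nonneg hτ] at h
  exact h

lemma norm_sq_le_dotProduct_self (v : Fin m → ℝ) : ‖v‖ ^ 2 ≤ v ⬝ᵥ v := by
  have h0 : 0 ≤ v ⬝ᵥ v := Finset.sum_nonneg fun i _ => mul_self_nonneg _
  have h : ‖v‖ ≤ √(v ⬝ᵥ v) := by
    refine (pi_norm_le_iff_of_nonneg (Real.sqrt_nonneg _)).2 fun i => ?_
    refine Real.abs_le_sqrt ?_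
    rw [pow_two]
    exact Finset.single_le_sum (f := fun i => v i * v i) (fun i _ => mul_self_nonneg _)
      (Finset.mem_univ i)
  calc ‖v‖ ^ 2 ≤ √(v ⬝ᵥ v) ^ 2 := pow_le_pow_left₀ (norm_nonneg _) h 2
    _ = v ⬝ᵥ v := Real.sq_sqrt h0

section Closed

variable {A : Matrix (Fin n) (Fin n) ℝ} {B : Matrix (Fin n) (Fin m) ℝ} {γ : ℝ}
  {P : Matrix (Fin n) (Fin n) ℝ} {l : (Fin n → ℝ) →L[ℝ] EuclideanSpace ℝ (Fin n)}

lemma IsRiccatiSolution.norm_feedback_le (hA : EigenvaluesImaginary A) (hγ : 0 < γ)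
    (h : IsRiccatiSolution A B γ P) (hl : ∀ x y, inner ℝ (l x) (l y) = x ⬝ᵥ P *ᵥ y)
    (z : Fin n → ℝ) : ‖Bᵀ *ᵥ (P *ᵥ z)‖ ≤ √(n * γ) * ‖l z‖ := by
  refine abs_le_of_sq_le_sq' ?_ (by positivity) |>.2
  rw [mul_pow, Real.sq_sqrt (by positivity), norm_sq_gram hl]
  exact (norm_sq_le_dotProduct_self _).trans (h.feedback_sq_le hA z)

lemma IsRiccatiSolution.norm_exp_neg_le (h : IsRiccatiSolution A B γ P) (hγ1 : γ ≤ 1)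
    (hl : ∀ x y, inner ℝ (l x) (l y) = x ⬝ᵥ P *ᵥ y) {s σ : ℝ} (hs : 0 ≤ s) (hsσ : s ≤ σ)
    (z : Fin n → ℝ) : ‖l (NormedSpace.exp (s • -A) *ᵥ z)‖ ≤ Real.exp σ * ‖l z‖ := by
  refine abs_le_of_sq_le_sq' ?_ (by positivity) |>.2
  rw [mul_pow, norm_sq_gram hl, norm_sq_gram hl, ← Real.exp_nat_mul]
  have h0 : 0 ≤ z ⬝ᵥ P *ᵥ z := by rw [← norm_sq_gram hl]; positivity
  refine (quadForm_exp_smul_le (k := γ) (fun w => ?_) hs z).trans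
    (mul_le_mul_of_nonneg_right (Real.exp_le_exp.2 ?_) h0)
  · have h1 := h.lyapunov_quadForm w
    have h2 : 0 ≤ (Bᵀ *ᵥ (P *ᵥ w)) ⬝ᵥ (Bᵀ *ᵥ (P *ᵥ w)) :=
      Finset.sum_nonneg fun i _ => mul_self_nonneg _
    simp only [Matrix.neg_mulVec, neg_dotProduct, Matrix.mulVec_neg, dotProduct_neg]
    linarith
  · push_cast
    nlinarith

lemma IsRiccatiSolution.norm_exp_closed_le (h : IsRiccatiSolution A B γ P) (hγ : 0 ≤ γ)
    (hl : ∀ x y, inner ℝ (l x) (l y) = x ⬝ᵥ P *ᵥ y) {s : ℝ} (hs : 0 ≤ s)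
    (z : Fin n → ℝ) :
    ‖l (NormedSpace.exp (s • (A + B * -(Bᵀ * P))) *ᵥ z)‖ ≤ ‖l z‖ := by
  refine abs_le_of_sq_le_sq' ?_ (by positivity) |>.2
  rw [norm_sq_gram hl, norm_sq_gram hl]
  refine (quadForm_exp_smul_le (k := 0) (fun w => ?_) hs z).trans (by simp)
  have h0 : 0 ≤ w ⬝ᵥ P *ᵥ w := by rw [← norm_sq_gram hl]; positivity
  have h1 := h.controlled_quadForm w (-(Bᵀ *ᵥ (P *ᵥ w)))
  have h2 : 0 ≤ (-(Bᵀ *ᵥ (P *ᵥ w))) ⬝ᵥ (-(Bᵀ *ᵥ (P *ᵥ w))) :=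
    Finset.sum_nonneg fun i _ => mul_self_nonneg _
  have e : (A + B * -(Bᵀ * P)) *ᵥ w = A *ᵥ w + B *ᵥ (-(Bᵀ *ᵥ (P *ᵥ w))) := by
    rw [Matrix.add_mulVec, ← Matrix.mulVec_mulVec, Matrix.neg_mulVec, Matrix.mulVec_mulVec _ Bᵀ]
  rw [e, h1, neg_add_cancel, dotProduct_zero]
  nlinarith

/-- The derivative of `e^{s(A+BF)} e^{-sA} z` in `s` is `e^{s(A+BF)} B F e^{-sA} z`, which contains
the small factor `F`. -/
lemma IsRiccatiSolution.norm_closed_sub_le (hA : EigenvaluesImaginary A)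
    (h : IsRiccatiSolution A B γ P) (hγ : 0 < γ) (hγ1 : γ ≤ 1)
    (hl : ∀ x y, inner ℝ (l x) (l y) = x ⬝ᵥ P *ᵥ y) {c : ℝ} (hc : 0 ≤ c)
    (hB : ∀ v, ‖l (B *ᵥ v)‖ ≤ c * ‖v‖) {σ : ℝ} (hσ : 0 ≤ σ) (z : Fin n → ℝ) :
    ‖l (NormedSpace.exp (σ • (A + B * -(Bᵀ * P))) *ᵥ (NormedSpace.exp (σ • -A) *ᵥ z) - z)‖ ≤
      c * (√(n * γ) * (Real.exp σ * ‖l z‖)) * σ := by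
  set Ac := A + B * -(Bᵀ * P) with hAc
  have hd : ∀ s ∈ Icc 0 σ, HasDerivWithinAt
      (fun s : ℝ => l (NormedSpace.exp (s • Ac) *ᵥ (NormedSpace.exp (s • -A) *ᵥ z)))
      (l (NormedSpace.exp (s • Ac) *ᵥ
        (B *ᵥ (-(Bᵀ *ᵥ (P *ᵥ (NormedSpace.exp (s • -A) *ᵥ z))))))) (Icc 0 σ) s := by
    intro s _
    have h1 := hasDerivWithinAt_exp_smul_mulVec (s := Icc 0 σ) Ac
      (hasDerivAt_exp_smul_mulVec_const (-A) z s).hasDerivWithinAt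
    refine (l.hasFDerivAt.comp_hasDerivWithinAt s h1).congr_deriv ?_
    have hcomm : Commute Ac (NormedSpace.exp (s • Ac)) :=
      ((Commute.refl Ac).smul_right s).exp_right
    rw [Matrix.mulVec_mulVec _ Ac, hcomm.eq, ← Matrix.mulVec_mulVec, ← Matrix.mulVec_add]
    congr 2
    rw [hAc, Matrix.add_mulVec, ← Matrix.mulVec_mulVec, Matrix.neg_mulVec, Matrix.neg_mulVec,
      Matrix.mulVec_mulVec _ Bᵀ]
    abel
  have hbound : ∀ s ∈ Icc 0 σ, ‖l (NormedSpace.exp (s • Ac) *ᵥ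
      (B *ᵥ (-(Bᵀ *ᵥ (P *ᵥ (NormedSpace.exp (s • -A) *ᵥ z))))))‖ ≤
      c * (√(n * γ) * (Real.exp σ * ‖l z‖)) := by
    intro s hs
    refine (h.norm_exp_closed_le hγ.le hl hs.1 _).trans ((hB _).trans ?_)
    rw [norm_neg]
    gcongr
    refine (h.norm_feedback_le hA hγ hl _).trans ?_
    gcongr
    exact h.norm_exp_neg_le hγ1 hl hs.1 hs.2 z
  have := (convex_Icc 0 σ).norm_image_sub_le_of_norm_hasDerivWithin_le hd hbound
    (left_mem_Icc.2 hσ) (right_mem_Icc.2 hσ)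
  rw [sub_zero, Real.norm_of_nonneg hσ, ← map_sub] at this
  simpa using this

lemma tppfGain_mulVec (A : Matrix (Fin n) (Fin n) ℝ) (B : Matrix (Fin n) (Fin m) ℝ)
    (P : Matrix (Fin n) (Fin n) ℝ) (σ : ℝ) (z : Fin n → ℝ) :
    tppfGain A B P σ *ᵥ z = -(Bᵀ *ᵥ (P *ᵥ
      (NormedSpace.exp (σ • (A + B * -(Bᵀ * P))) *ᵥ (NormedSpace.exp (σ • -A) *ᵥ z)))) := by
  simp only [tppfGain]
  rw [← Matrix.mulVec_mulVec, ← Matrix.mulVec_mulVec, Matrix.neg_mulVec, ← Matrix.mulVec_mulVec,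
    smul_neg]

end Closed

lemma hasDerivWithinAt_predictor (A : Matrix (Fin n) (Fin n) ℝ)
    (Bd : Fin 3 → Matrix (Fin n) (Fin m) ℝ) (τ : Fin 3 → ℝ) {x : ℝ → Fin n → ℝ}
    {u : ℝ → Fin m → ℝ} (hu : Continuous u) {S : Set ℝ} {t : ℝ}
    (hx : HasDerivWithinAt x (A *ᵥ x t + ∑ i, Bd i *ᵥ u (t - τ i)) S t) :
    HasDerivWithinAt (fun t => x t + ∑ i, pendingInput A (Bd i) (τ i) u t)
      (A *ᵥ (x t + ∑ i, pendingInput A (Bd i) (τ i) u t) + reducedInput A Bd τ *ᵥ u t) S t := by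
  have h := hx.fun_add (HasDerivWithinAt.fun_sum (u := Finset.univ) fun i _ =>
    (hasDerivAt_pendingInput A (Bd i) (τ i) hu t).hasDerivWithinAt)
  refine h.congr_deriv ?_
  rw [reducedInput, Finset.sum_sub_distrib, Finset.sum_add_distrib, Matrix.mulVec_add,
    Matrix.sum_mulVec, Matrix.mulVec_sum]
  abel

/-! ### Closing the loop. -/

lemma delayDecay_closedLoop {A : Matrix (Fin n) (Fin n) ℝ} (hA : EigenvaluesImaginary A)
    {Bd : Fin 3 → Matrix (Fin n) (Fin m) ℝ} {τ : Fin 3 → ℝ} {r : ℝ} (hτ : ∀ i, 0 ≤ τ i)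
    (hτr : ∀ i, τ i ≤ r) {γ : ℝ} (hγ : 0 < γ) (hγ1 : γ ≤ 1) {P : Matrix (Fin n) (Fin n) ℝ}
    (h : IsRiccatiSolution A (reducedInput A Bd τ) γ P)
    {l : (Fin n → ℝ) →L[ℝ] EuclideanSpace ℝ (Fin n)}
    (hl : ∀ x y, inner ℝ (l x) (l y) = x ⬝ᵥ P *ᵥ y) {c : ℝ} (hc : 0 ≤ c)
    (hB : ∀ v, ‖l (reducedInput A Bd τ *ᵥ v)‖ ≤ c * ‖v‖)
    (hBd : ∀ i v, ‖l (Bd i *ᵥ v)‖ ≤ c * ‖v‖) {σ : ℝ} (hσ : σ = τ 0 + τ 1 + τ 2)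
    (hε : 2 * c * Real.exp σ ^ 2 * σ * (n + 1) * √(n * γ) ≤ 1 / 4)
    {x : ℝ → Fin n → ℝ} (hxc : Continuous x)
    (hx : ∀ t, 0 ≤ t → HasDerivWithinAt x (A *ᵥ x t + ∑ i, Bd i *ᵥ
      (tppfGain A (reducedInput A Bd τ) P σ *ᵥ x (t - τ i))) (Ici 0) t) :
    ∃ b, DelayDecay (fun t => ‖l (x t)‖) b r γ
      (2 * c * Real.exp σ ^ 2 * σ * (n + 1) * √(n * γ)) := by
  set B := reducedInput A Bd τ with hBdef
  set K := tppfGain A B P σ with hK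
  set u : ℝ → Fin m → ℝ := fun t => K *ᵥ x t with hudef
  have hu : Continuous u := continuous_const.matrix_mulVec hxc
  set y : ℝ → Fin n → ℝ := fun t => x t + ∑ i, pendingInput A (Bd i) (τ i) u t with hy
  set ρ := √(n * γ) with hρ
  set κ := Real.exp σ with hκ
  have hρ0 : 0 ≤ ρ := Real.sqrt_nonneg _
  have hτσ : ∀ i, τ i ≤ σ := by
    have h0 := hτ 0
    have h1 := hτ 1
    have h2 := hτ 2
    intro i
    fin_cases i <;> simp <;> linarith
  have hσ0 : 0 ≤ σ := (hτ 0).trans (hτσ 0)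
  have hκ1 : 1 ≤ κ := Real.one_le_exp hσ0
  have hyd : ∀ t, 0 ≤ t → HasDerivWithinAt y (A *ᵥ y t + B *ᵥ u t) (Ici 0) t :=
    fun t ht => hasDerivWithinAt_predictor A Bd τ hu (hx t ht)
  have hdiff : ∀ t M, (∀ s ∈ Icc (t - r) t, ‖l (x s)‖ ≤ M) →
      ‖l (x t - y t)‖ ≤ c * κ ^ 2 * ρ * M * σ := by
    intro t M hM
    have hunorm : ∀ s ∈ Icc (t - r) t, ‖u s‖ ≤ ρ * (κ * M) := by
      intro s hs
      rw [hudef, hK]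
      simp only
      rw [tppfGain_mulVec, norm_neg]
      refine (h.norm_feedback_le hA hγ hl _).trans ?_
      refine mul_le_mul_of_nonneg_left ?_ hρ0
      refine (h.norm_exp_closed_le hγ.le hl hσ0 _).trans ?_
      refine (h.norm_exp_neg_le hγ1 hl hσ0 le_rfl _).trans ?_
      exact mul_le_mul_of_nonneg_left (hM s hs) (by positivity)
    have hpend : ∀ i, ‖l (pendingInput A (Bd i) (τ i) u t)‖ ≤ κ * (c * (ρ * (κ * M))) * τ i := by
      intro i
      refine norm_pendingInput_le l A (Bd i) (hτ i) hu t fun s hs => ?_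
      refine (h.norm_exp_neg_le hγ1 hl (sub_nonneg.2 hs.1)
        (by linarith [hs.2, hτσ i] : s - (t - τ i) ≤ σ) _).trans ?_
      refine mul_le_mul_of_nonneg_left ?_ (by positivity)
      refine (hBd i _).trans (mul_le_mul_of_nonneg_left (hunorm s ⟨?_, hs.2⟩) hc)
      linarith [hs.1, hτr i]
    have e : x t - y t = -∑ i, pendingInput A (Bd i) (τ i) u t := by rw [hy]; simp
    rw [e, map_neg, norm_neg, map_sum]
    refine (norm_sum_le_of_le Finset.univ fun i _ => hpend i).trans (le_of_eq ?_)
    rw [← Finset.mul_sum, Fin.sum_univ_three, ← hσ]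
    ring
  have hM0 : ∀ t M, (∀ s ∈ Icc (t - r) t, ‖l (x s)‖ ≤ M) → 0 ≤ M := fun t M hM =>
    (norm_nonneg _).trans (hM t ⟨by linarith [(hτ 0).trans (hτr 0)], le_rfl⟩)
  have hn : (0 : ℝ) ≤ n := Nat.cast_nonneg n
  refine ⟨fun t => ‖l (y t)‖, hγ, (hτ 0).trans (hτr 0), by positivity, hε,
    (l.continuous.comp hxc).norm.continuousOn, fun t => norm_nonneg _, fun t => norm_nonneg _,
    fun t ht M hM => ?_, fun t => (A *ᵥ y t + B *ᵥ u t) ⬝ᵥ P *ᵥ y t +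
      y t ⬝ᵥ P *ᵥ (A *ᵥ y t + B *ᵥ u t), fun t ht => ⟨?_, fun M hM => ?_⟩⟩
  · have hM' := hM0 t M hM
    refine (abs_norm_sub_norm_le _ _).trans ?_
    rw [← map_sub]
    refine (hdiff t M hM).trans ?_
    have h1 : 0 ≤ c * κ ^ 2 * ρ * M * σ := by positivity
    have h2 : 0 ≤ c * κ ^ 2 * ρ * M * σ * n := by positivity
    linarith
  · simp only [norm_sq_gram hl]
    exact hasDerivWithinAt_bilin P (hyd t ht) (hyd t ht)
  · have hM' := hM0 t M hM
    set z := NormedSpace.exp (σ • (A + B * -(Bᵀ * P))) *ᵥ (NormedSpace.exp (σ • -A) *ᵥ x t) with hz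
    have hu0 : 0 ≤ u t ⬝ᵥ u t := Finset.sum_nonneg fun i _ => mul_self_nonneg _
    have e : u t + Bᵀ *ᵥ (P *ᵥ y t) = -(Bᵀ *ᵥ (P *ᵥ (z - y t))) := by
      have : u t = -(Bᵀ *ᵥ (P *ᵥ z)) := tppfGain_mulVec A B P σ (x t)
      rw [this, Matrix.mulVec_sub, Matrix.mulVec_sub]
      abel
    beta_reduce
    rw [h.controlled_quadForm, e, neg_dotProduct_neg]
    have h1 := h.feedback_sq_le hA (z - y t)
    rw [← norm_sq_gram hl] at h1
    have hxt : ‖l (x t)‖ ≤ M := hM t ⟨by linarith [(hτ 0).trans (hτr 0)], le_rfl⟩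
    have h2 : ‖l (z - y t)‖ ≤ 2 * c * κ ^ 2 * σ * ρ * M := by
      -- The truncation error and the pending inputs obey the same bound, hence the factor `2` in
      -- `ε`.
      have e2 : z - y t = (z - x t) + (x t - y t) := by abel
      rw [e2, map_add]
      refine (norm_add_le _ _).trans ?_
      have h3 := h.norm_closed_sub_le hA hγ hγ1 hl hc hB hσ0 (x t)
      have h4 : c * (ρ * (κ * ‖l (x t)‖)) * σ ≤ c * (ρ * (κ ^ 2 * M)) * σ := by
        gcongr
        nlinarith
      linarith [hdiff t M hM]
    have h5 : ‖l (z - y t)‖ ^ 2 ≤ (2 * c * κ ^ 2 * σ * ρ * M) ^ 2 :=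
      pow_le_pow_left₀ (norm_nonneg _) h2 2
    -- The low-gain factor supplies the `γ` matching the decay rate; `n ≤ (n + 1)²` puts the
    -- dimension inside the square.
    have h6 : n * γ * ‖l (z - y t)‖ ^ 2 ≤
        γ * (2 * c * κ ^ 2 * σ * (n + 1) * ρ * M) ^ 2 := by
      calc n * γ * ‖l (z - y t)‖ ^ 2 ≤ n * γ * (2 * c * κ ^ 2 * σ * ρ * M) ^ 2 := by gcongr
        _ ≤ (n + 1) ^ 2 * γ * (2 * c * κ ^ 2 * σ * ρ * M) ^ 2 := by
          gcongr
          nlinarith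
        _ = _ := by ring
    rw [← norm_sq_gram hl]
    linarith

lemma closedLoopAsymptoticallyStable_of_small {A : Matrix (Fin n) (Fin n) ℝ}
    (hA : EigenvaluesImaginary A)
    {Bd : Fin 3 → Matrix (Fin n) (Fin m) ℝ} {τ : Fin 3 → ℝ} {r : ℝ} (hτ : ∀ i, 0 ≤ τ i)
    (hτr : ∀ i, τ i ≤ r) {γ : ℝ} (hγ : 0 < γ) (hγ1 : γ ≤ 1) {P : Matrix (Fin n) (Fin n) ℝ}
    (h : IsRiccatiSolution A (reducedInput A Bd τ) γ P)
    {l : (Fin n → ℝ) →L[ℝ] EuclideanSpace ℝ (Fin n)}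
    (hl : ∀ x y, inner ℝ (l x) (l y) = x ⬝ᵥ P *ᵥ y) {c : ℝ} (hc : 0 ≤ c)
    (hB : ∀ v, ‖l (reducedInput A Bd τ *ᵥ v)‖ ≤ c * ‖v‖)
    (hBd : ∀ i v, ‖l (Bd i *ᵥ v)‖ ≤ c * ‖v‖) {σ : ℝ} (hσ : σ = τ 0 + τ 1 + τ 2)
    (hε : 2 * c * Real.exp σ ^ 2 * σ * (n + 1) * √(n * γ) ≤ 1 / 4) :
    ClosedLoopAsymptoticallyStable A Bd τ r (tppfGain A (reducedInput A Bd τ) P σ) := by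
  have hr : 0 ≤ r := (hτ 0).trans (hτr 0)
  obtain ⟨k, hk, hkl⟩ := exists_norm_le_gram h.1 hl
  have key : ∀ x : ℝ → Fin n → ℝ,
      IsTrajectory A Bd τ r x (fun t => tppfGain A (reducedInput A Bd τ) P σ *ᵥ x t) →
      ∃ a b, DelayDecay a b r γ (2 * c * Real.exp σ ^ 2 * σ * (n + 1) * √(n * γ)) ∧
        ∀ t, -r ≤ t → a t = ‖l (x t)‖ := by
    rintro x ⟨hxc, hx⟩
    -- Freezing `x` before time `-r` makes it continuous on all of `ℝ`, as the predictor integrals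
    -- require, without affecting the equation.
    have hext : ∀ t, -r ≤ t → x (max t (-r)) = x t := fun t ht => by rw [max_eq_left ht]
    obtain ⟨b, hb⟩ := delayDecay_closedLoop hA hτ hτr hγ hγ1 h hl hc hB hBd hσ hε
      (x := fun t => x (max t (-r)))
      (hxc.comp_continuous (continuous_id.max continuous_const) fun t => mem_Ici.2 (le_max_right _ _))
      (fun t ht => by
        have h1 := (hx t ht).congr (f₁ := fun t => x (max t (-r)))
          (fun s hs => hext s ((neg_nonpos.2 hr).trans hs)) (hext t ((neg_nonpos.2 hr).trans ht))
        refine h1.congr_deriv ?_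
        rw [hext t ((neg_nonpos.2 hr).trans ht)]
        congr 1
        refine Finset.sum_congr rfl fun i _ => ?_
        rw [hext (t - τ i) (by linarith [hτr i])])
    exact ⟨_, b, hb, fun t ht => by simp only [hext t ht]⟩
  refine ⟨fun ε hε0 => ?_, fun x hx => ?_⟩
  · set L := k * (4 * (‖l‖ + 1)) with hL
    have hL0 : 0 < L := by positivity
    refine ⟨ε / (2 * L), by positivity, fun x hx hinit t ht => ?_⟩
    obtain ⟨a, b, hab, ha⟩ := key x hx
    have hbd := hab.bounded (S₀ := (‖l‖ + 1) * (ε / (2 * L))) (fun s hs => by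
      rw [ha s hs.1]
      refine (l.le_opNorm _).trans ?_
      exact mul_le_mul (by linarith) (hinit s hs).le (norm_nonneg _) (by positivity)) ht
    rw [ha t (by linarith)] at hbd
    calc ‖x t‖ ≤ k * ‖l (x t)‖ := hkl _
      _ ≤ k * (4 * ((‖l‖ + 1) * (ε / (2 * L)))) := by gcongr
      _ = L * (ε / (2 * L)) := by rw [hL]; ring
      _ = ε / 2 := by field_simp
      _ < ε := by linarith
  · obtain ⟨a, b, hab, ha⟩ := key x hx
    refine squeeze_zero_norm' ?_ (by simpa using hab.tendsto_zero.const_mul k)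
    filter_upwards [eventually_ge_atTop (0 : ℝ)] with t ht
    rw [ha t (by linarith)]
    exact hkl _

end TPPF

theorem theorem1 {n m : ℕ} (A : Matrix (Fin n) (Fin n) ℝ)
    (Bd : Fin 3 → Matrix (Fin n) (Fin m) ℝ) (τ : Fin 3 → ℝ)
    (hτ_nonneg : 0 ≤ τ 0) (hτ_mono : Monotone τ)
    (hctrl : TPPF.Controllable A (TPPF.reducedInput A Bd τ))
    (himag : TPPF.EigenvaluesImaginary A) :
    (∀ γ : ℝ, 0 < γ → ∃! P : Matrix (Fin n) (Fin n) ℝ,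
      TPPF.IsRiccatiSolution A (TPPF.reducedInput A Bd τ) γ P) ∧
    ∃ γstar : ℝ, 0 < γstar ∧ ∀ γ : ℝ, 0 < γ → γ < γstar →
      ∀ P : Matrix (Fin n) (Fin n) ℝ,
        TPPF.IsRiccatiSolution A (TPPF.reducedInput A Bd τ) γ P →
        TPPF.ClosedLoopAsymptoticallyStable A Bd τ (τ 2)
          (TPPF.tppfGain A (TPPF.reducedInput A Bd τ) P (τ 0 + τ 1 + τ 2)) := by
  refine ⟨fun γ hγ => TPPF.existsUnique_isRiccatiSolution hctrl himag hγ, ?_⟩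
  obtain ⟨P₁, hP₁, -⟩ := TPPF.existsUnique_isRiccatiSolution hctrl himag one_pos
  obtain ⟨l₁, hl₁⟩ := TPPF.exists_gram_map hP₁.1.posSemidef
  let opn (M : Matrix (Fin n) (Fin m) ℝ) : ℝ := ‖l₁.comp (Matrix.mulVecLin M).toContinuousLinearMap‖
  have hopn : ∀ M v, ‖l₁ (M *ᵥ v)‖ ≤ opn M * ‖v‖ := fun M v =>
    (l₁.comp (Matrix.mulVecLin M).toContinuousLinearMap).le_opNorm v
  have hopn0 : ∀ M, 0 ≤ opn M := fun M => norm_nonneg _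
  set c := opn (TPPF.reducedInput A Bd τ) + ∑ i, opn (Bd i) with hc
  -- `c` is measured in the norm of `P(1)`, so it does not depend on `γ` and the smallness condition
  -- holds as `γ → 0`.
  have hc0 : 0 ≤ c := add_nonneg (hopn0 _) (Finset.sum_nonneg fun i _ => hopn0 _)
  have hτ : ∀ i, 0 ≤ τ i := fun i => hτ_nonneg.trans (hτ_mono (Fin.zero_le i))
  set σ := τ 0 + τ 1 + τ 2 with hσ
  have hlim : Tendsto (fun γ : ℝ => 2 * c * Real.exp σ ^ 2 * σ * (n + 1) * √(n * γ)) (𝓝 0) (𝓝 0) := by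
    have : Continuous fun γ : ℝ => 2 * c * Real.exp σ ^ 2 * σ * (n + 1) * √(n * γ) := by fun_prop
    simpa using this.tendsto 0
  obtain ⟨δ, hδ, hsmall⟩ := Metric.eventually_nhds_iff.1
    (hlim.eventually_le_const (show (0 : ℝ) < 1 / 4 by norm_num))
  refine ⟨min 1 δ, lt_min one_pos hδ, fun γ hγ hγs P hP => ?_⟩
  have hγ1 : γ ≤ 1 := (hγs.trans_le (min_le_left _ _)).le
  obtain ⟨l, hl⟩ := TPPF.exists_gram_map hP.1.posSemidef
  have hle : ∀ z, ‖l z‖ ≤ ‖l₁ z‖ := fun z => by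
    refine abs_le_of_sq_le_sq' ?_ (norm_nonneg _) |>.2
    rw [TPPF.norm_sq_gram hl, TPPF.norm_sq_gram hl₁]
    exact hP.dotProduct_le himag hγ hγ1 hP₁ z
  refine TPPF.closedLoopAsymptoticallyStable_of_small himag hτ
    (fun i => hτ_mono (Fin.le_last i)) hγ hγ1 hP hl hc0
    (fun v => (hle _).trans ((hopn _ v).trans (mul_le_mul_of_nonneg_right ?_ (norm_nonneg _))))
    (fun i v => (hle _).trans ((hopn _ v).trans (mul_le_mul_of_nonneg_right ?_ (norm_nonneg _))))
    hσ (hsmall ?_)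
  · exact le_add_of_nonneg_right (Finset.sum_nonneg fun i _ => hopn0 _)
  · exact (Finset.single_le_sum (f := fun i => opn (Bd i)) (fun i _ => hopn0 _)
      (Finset.mem_univ i)).trans (le_add_of_nonneg_left (hopn0 _))
  · rw [dist_zero_right, Real.norm_of_nonneg hγ.le]
    exact hγs.trans_le (min_le_right _ _)
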